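/- Let $d\ge 1$, let $Z = 2^{d-1}\cdot\frac{2\pi^{d/2}}{\Gamma(d/2)}$ and let $\mu$ be the measure on $\mathbb{R}^d$ with Lebesgue density $e^{|x|^2/4}/Z$. For a measure $\nu$ which is either $\mu$ or Lebesgue measure, let $H^2(\nu)$ be the space of (classes of) real-valued $f\in L^2(\nu)$ whose weak derivatives $\partial_\beta f$, $|\beta|\le 2$, all lie in $L^2(\nu)$, with its usual norm $\big(\|f\|_{L^2(\nu)}^2+\sum_{i}\|\partial_{x_i}f\|_{L^2(\nu)}^2+\sum_{i,j}\|\partial_{x_ix_j}f\|_{L^2(\nu)}^2\big)^{1/2}$; for Lebesgue measure it is denoted $H^2(\mathbb{R}^d)$. Let $\mathcal{L}u = -\frac{x}{2}\cdot\nabla u-\Delta u$ (with weak derivatives). Then $\mathcal{L}$ is a well-defined bounded linear map from $H^2(\mu)$ to $L^2(\mu)$; for every $f\in L^2(\mu)$ there is a unique $u\in H^2(\mu)$ with $\mathcal{L}u=f$; and $\mathcal{L}^{-1}:L^2(\mu)\to H^2(\mu)$ is bounded. Thus $\|u\|_{H^2(\mu)}:=\|\mathcal{L}u\|_{L^2(\mu)}$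 is a norm on $H^2(\mu)$ which is equivalent to the usual one. Furthermore, if $u\in H^2(\mu)$ and $\varphi(x)=e^{|x|^2/8}u(x)$, then $\varphi\in H^2(\mathbb{R}^d)$ and $$\|D^2\varphi\|_{L^2(\mathbb{R}^d)}=\|\Delta\varphi\|_{L^2(\mathbb{R}^d)}\le\sqrt{Z}\,\|u\|_{H^2(\mu)},$$ where $\|D^2\varphi\|_{L^2(\mathbb{R}^d)}=\big(\sum_{i,j=1}^d\|\partial_{x_ix_j}\varphi\|_{L^2(\mathbb{R}^d)}^2\big)^{1/2}$ and $\|u\|_{H^2(\mu)}=\|\mathcal{L}u\|_{L^2(\mu)}$. -/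

import Mathlib

open MeasureTheory
open scoped ContDiff ENNReal

namespace WeightedSobolev

noncomputable section

/-- The Euclidean space `ℝ^d`. -/
abbrev E (d : ℕ) : Type := EuclideanSpace ℝ (Fin d)

/-- The surface area `ω_{d-1} = 2 π^{d/2} / Γ(d/2)` of the unit sphere of `ℝ^d` (`d ≥ 1`). -/
def sphereArea (d : ℕ) : ℝ := 2 * Real.pi ^ ((d : ℝ) / 2) / Real.Gamma ((d : ℝ) / 2)

/-- The normalisation `Z = 2^{d-1} ω_{d-1}` (`d ≥ 1`). -/
def Z (d : ℕ) : ℝ := 2 ^ (d - 1) * sphereArea d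

/-- The measure `μ(x) dx` on `ℝ^d` with density `μ(x) = e^{|x|²/4} / Z`. -/
def mu (d : ℕ) : Measure (E d) :=
  volume.withDensity fun x => ENNReal.ofReal (Real.exp (‖x‖ ^ 2 / 4) / Z d)

/-- The classical partial derivative `∂_{α 0} ⋯ ∂_{α (k-1)} η` of a smooth function. The
multi-indices of order `k` are written as `k`-tuples of coordinate indices. -/
def partialDeriv {d k : ℕ} (α : Fin k → Fin d) (η : E d → ℝ) (x : E d) : ℝ :=
  iteratedFDeriv ℝ k η x fun j => EuclideanSpace.single (α j) (1 : ℝ)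

/-- `g` is the weak (distributional) derivative `∂_α f` on `ℝ^d`, tested against `C_c^∞(ℝ^d)`. -/
def HasWeakDeriv {d k : ℕ} (α : Fin k → Fin d) (f g : E d → ℝ) : Prop :=
  LocallyIntegrable f volume ∧ LocallyIntegrable g volume ∧
    ∀ η : E d → ℝ, ContDiff ℝ ∞ η → HasCompactSupport η →
      ∫ x, f x * partialDeriv α η x = (-1) ^ k * ∫ x, g x * η x

open Classical in
/-- A representative of the weak derivative `∂_α f` (unique up to a null set when it exists; the
value is `0` when there is none). -/
def weakDeriv {d k : ℕ} (α : Fin k → Fin d) (f : E d → ℝ) : E d → ℝ :=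
  if h : ∃ g, HasWeakDeriv α f g then h.choose else 0

/-- `f ∈ H^n(ν)`: `f ∈ L²(ν)` and all weak derivatives `∂_α f` of order at most `n` exist and lie
in `L²(ν)`. For `ν = volume` this is `H^n(ℝ^d)`, for `ν = mu d` it is `H^n(μ)`. -/
def MemH {d : ℕ} (n : ℕ) (ν : Measure (E d)) (f : E d → ℝ) : Prop :=
  MemLp f 2 ν ∧
    ∀ k ≤ n, ∀ α : Fin k → Fin d, ∃ g, HasWeakDeriv α f g ∧ MemLp g 2 ν

/-- The usual norm `(∑_{|α| ≤ n} ‖∂_α f‖²_{L²(ν)})^{1/2}` of `H^n(ν)`. -/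
def sobolevNorm {d : ℕ} (n : ℕ) (ν : Measure (E d)) (f : E d → ℝ) : ℝ :=
  √(∑ k ∈ Finset.range (n + 1), ∑ α : Fin k → Fin d, lpNorm (weakDeriv α f) 2 ν ^ 2)

/-- The (weak) Laplacian `Δ f = ∑ i, ∂_i ∂_i f`. -/
def laplacian {d : ℕ} (f : E d → ℝ) (x : E d) : ℝ :=
  ∑ i : Fin d, weakDeriv ![i, i] f x

/-- The operator `𝓛 u = - (x/2) · ∇u - Δu`, with weak derivatives. -/
def opL {d : ℕ} (u : E d → ℝ) (x : E d) : ℝ :=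
  -(∑ i : Fin d, x i / 2 * weakDeriv ![i] u x) - laplacian u x

/-- The norm `‖u‖_{H²(μ)} := ‖𝓛 u‖_{L²(μ)}`. -/
def normH2 {d : ℕ} (u : E d → ℝ) : ℝ := lpNorm (opL u) 2 (mu d)

/-- `‖D² f‖_{L²(ℝ^d)} = (∑_{i,j} ‖∂_{x_i x_j} f‖²_{L²(ℝ^d)})^{1/2}`. -/
def hessianNorm {d : ℕ} (f : E d → ℝ) : ℝ :=
  √(∑ i : Fin d, ∑ j : Fin d, lpNorm (weakDeriv ![i, j] f) 2 volume ^ 2)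

end

end WeightedSobolev

/-!
Conjugation by `e^{|x|²/8}` is, up to the factor `√Z`, an isometry of `L²(μ)` onto `L²(ℝ^d)`, and it
turns `𝓛` into the Schrödinger operator `-Δ + |x|²/16 + d/4`. In `L²(μ)` itself
`𝓛 = ∑ ∂_i^* ∂_i` with `∂_i^* = -(∂_i + x_i/2)`. Everything is first proved for test functions
and then carried over to `H²(μ)` by approximation.

*A priori estimates.* For test functions, `⟨𝓛u, u⟩ = ‖∇u‖²`, and the commutator
`∂_i 𝓛 = 𝓛 ∂_i - ∂_i/2` gives the Bochner identity `‖𝓛u‖² = ‖D²u‖² - ‖∇u‖²/2`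
(`integral_classicalL_sq`). Together with the Hardy–Poincaré inequality `hardy_poincare`, which bounds
both `v` and `x_i v` by `∂_i v`, these control the full norm of `H²(μ)` by `𝓛u`, and `𝓛u` by the
full norm. For `φ = e^{|x|²/8} u`, two integrations by parts give `‖D²φ‖ = ‖Δφ‖`
(`integral_lap_sq`), and one integration by parts shows `‖Δφ‖ ≤ ‖(-Δ + |x|²/16 + d/4) φ‖`
(`integral_lap_sq_le`).

*Density.* Test functions are dense in `H²(μ)`, by truncation and mollification
(`IsH2.exists_test_approx`), so the estimates and identities pass to all of `H²(μ)`. The term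
`x_i ∂_i u` in `𝓛u` lies in `L²(μ)` because of the Hardy–Poincaré inequality.

*Surjectivity.* By the a priori estimates it is enough that `𝓛` has dense range on test functions.
A function orthogonal to that range corresponds to some `ζ ∈ L²(ℝ^d)` with
`-Δζ + (|x|²/16 + d/4) ζ = 0` in the sense of distributions. The mollified equation is
tested with `χ²` times the mollification of `ζ`, where `χ` is a cutoff; in the limit this yields
`∫ χ² ζ² ≤ 4 ∫ |∇χ|² ζ²` (`energy_le`); for growing cutoffs the right side vanishes, so `ζ = 0`.
-/

namespace WeightedSobolev

open Filter Topology

variable {d : ℕ}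

/-! ### Partial derivatives and test functions -/

/-- The classical partial derivative `∂_i f`. -/
noncomputable def pd {d : ℕ} (i : Fin d) (f : E d → ℝ) (x : E d) : ℝ :=
  fderiv ℝ f x (EuclideanSpace.single i (1 : ℝ))

/-- The test functions, `C_c^∞(ℝ^d)`. -/
def IsTest {d : ℕ} (f : E d → ℝ) : Prop := ContDiff ℝ ∞ f ∧ HasCompactSupport f


lemma contDiff_pd {f : E d → ℝ} (hf : ContDiff ℝ ∞ f) (i : Fin d) : ContDiff ℝ ∞ (pd i f) := by
  have : ContDiff ℝ ∞ (fderiv ℝ f) := hf.fderiv_right (by simp)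
  exact this.clm_apply contDiff_const

lemma HasCompactSupport.pd {f : E d → ℝ} (hf : HasCompactSupport f) (i : Fin d) :
    HasCompactSupport (pd i f) := by
  have : HasCompactSupport (fderiv ℝ f) := hf.fderiv (𝕜 := ℝ)
  exact this.comp_left (g := fun T : E d →L[ℝ] ℝ => T (EuclideanSpace.single i 1)) (by simp)

lemma pd_mul {f g : E d → ℝ} (hf : ContDiff ℝ ∞ f) (hg : ContDiff ℝ ∞ g) (i : Fin d) :
    pd i (fun x => f x * g x) = fun x => pd i f x * g x + f x * pd i g x := by
  funext x
  have h1 := (hf.differentiable (by simp)) x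
  have h2 := (hg.differentiable (by simp)) x
  simp only [pd]
  rw [fderiv_fun_mul h1 h2]
  simp
  ring

lemma pd_add {f g : E d → ℝ} (hf : ContDiff ℝ ∞ f) (hg : ContDiff ℝ ∞ g) (i : Fin d) :
    pd i (fun x => f x + g x) = fun x => pd i f x + pd i g x := by
  funext x
  have h1 := (hf.differentiable (by simp)) x
  have h2 := (hg.differentiable (by simp)) x
  simp only [pd]
  rw [fderiv_fun_add h1 h2]
  simp

lemma pd_sub {f g : E d → ℝ} (hf : ContDiff ℝ ∞ f) (hg : ContDiff ℝ ∞ g) (i : Fin d) :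
    pd i (fun x => f x - g x) = fun x => pd i f x - pd i g x := by
  funext x
  have h1 := (hf.differentiable (by simp)) x
  have h2 := (hg.differentiable (by simp)) x
  simp only [pd]
  rw [fderiv_fun_sub h1 h2]
  simp

lemma pd_const_mul {f : E d → ℝ} (hf : ContDiff ℝ ∞ f) (c : ℝ) (i : Fin d) :
    pd i (fun x => c * f x) = fun x => c * pd i f x := by
  funext x
  have h1 := (hf.differentiable (by simp)) x
  simp only [pd]
  rw [fderiv_const_mul h1]
  simp

lemma pd_comp_const_smul {f : E d → ℝ} (hf : ContDiff ℝ ∞ f) (c : ℝ) (i : Fin d) :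
    pd i (fun x => f (c • x)) = fun x => c * pd i f (c • x) := by
  funext x
  have h1 := (hf.differentiable (by simp)) (c • x)
  have h2 : HasFDerivAt (fun x : E d => c • x) (c • ContinuousLinearMap.id ℝ (E d)) x :=
    (hasFDerivAt_id x).const_smul c
  have h3 := (h1.hasFDerivAt.comp x h2).fderiv
  simp only [pd]
  rw [show (fun x => f (c • x)) = f ∘ fun x => c • x from rfl, h3]
  simp

lemma pd_comp_sub_left {f : E d → ℝ} (hf : ContDiff ℝ ∞ f) (a : E d) (i : Fin d) :
    pd i (fun y => f (a - y)) = fun y => - pd i f (a - y) := by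
  funext x
  have h1 := (hf.differentiable (by simp)) (a - x)
  have h2 : HasFDerivAt (fun x : E d => a - x) (- ContinuousLinearMap.id ℝ (E d)) x :=
    (hasFDerivAt_id x).const_sub a
  have h3 := (h1.hasFDerivAt.comp x h2).fderiv
  simp only [pd]
  rw [show (fun x => f (a - x)) = f ∘ fun x => a - x from rfl, h3]
  simp

lemma contDiff_coord (i : Fin d) : ContDiff ℝ ∞ (fun x : E d => x i) := by
  fun_prop

lemma pd_coord (i j : Fin d) : pd i (fun x : E d => x j) = fun _ => if i = j then 1 else 0 := by
  funext x
  have : HasFDerivAt (fun x : E d => x j) (EuclideanSpace.proj j : E d →L[ℝ] ℝ) x :=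
    (EuclideanSpace.proj j : E d →L[ℝ] ℝ).hasFDerivAt
  simp only [pd]
  rw [this.fderiv]
  simp [eq_comm]

/-- The Gaussian factor `e^{c|x|²}`. -/
noncomputable def gauss (d : ℕ) (c : ℝ) (x : E d) : ℝ := Real.exp (c * ‖x‖ ^ 2)

lemma contDiff_gauss (c : ℝ) : ContDiff ℝ ∞ (gauss d c) := by
  have : ContDiff ℝ ∞ (fun x : E d => ‖x‖ ^ 2) := contDiff_norm_sq ℝ
  exact (contDiff_const.mul this).exp

lemma gauss_pos (c : ℝ) (x : E d) : 0 < gauss d c x := Real.exp_pos _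

lemma gauss_mul (a b : ℝ) (x : E d) : gauss d a x * gauss d b x = gauss d (a + b) x := by
  simp only [gauss, ← Real.exp_add]; ring_nf

lemma gauss_zero (x : E d) : gauss d 0 x = 1 := by simp [gauss]

lemma pd_gauss (c : ℝ) (i : Fin d) : pd i (gauss d c) = fun x => 2 * c * x i * gauss d c x := by
  funext x
  have h := ((hasStrictFDerivAt_norm_sq (F := E d) x).hasFDerivAt.const_mul c).exp
  simp only [pd]
  rw [show gauss d c = fun x => Real.exp (c * ‖x‖ ^ 2) from rfl, h.fderiv]
  simp [EuclideanSpace.inner_single_right]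
  ring

lemma pd_pd {f : E d → ℝ} (hf : ContDiff ℝ ∞ f) (i j : Fin d) (x : E d) :
    pd i (pd j f) x =
      fderiv ℝ (fderiv ℝ f) x (EuclideanSpace.single i 1) (EuclideanSpace.single j 1) := by
  have hd : DifferentiableAt ℝ (fderiv ℝ f) x :=
    ((hf.fderiv_right (m := ∞) (by simp)).differentiable (by simp)) x
  have := (hd.hasFDerivAt.clm_apply
    (hasFDerivAt_const (EuclideanSpace.single j (1 : ℝ)) x)).fderiv
  rw [pd, show pd j f = fun y => fderiv ℝ f y (EuclideanSpace.single j 1) from rfl, this]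
  simp

lemma pd_comm {f : E d → ℝ} (hf : ContDiff ℝ ∞ f) (i j : Fin d) :
    pd i (pd j f) = pd j (pd i f) := by
  funext x
  have hs : IsSymmSndFDerivAt ℝ f x :=
    (contDiff_infty.1 hf 2).contDiffAt.isSymmSndFDerivAt (by simp)
  rw [pd_pd hf, pd_pd hf]
  exact hs.eq _ _

lemma partialDeriv_zero (α : Fin 0 → Fin d) (η : E d → ℝ) : partialDeriv α η = η := by
  funext x; simp [partialDeriv]

lemma partialDeriv_one (α : Fin 1 → Fin d) (η : E d → ℝ) : partialDeriv α η = pd (α 0) η := by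
  funext x; simp [partialDeriv, pd]

lemma partialDeriv_two (α : Fin 2 → Fin d) {η : E d → ℝ} (hη : ContDiff ℝ ∞ η) :
    partialDeriv α η = pd (α 0) (pd (α 1) η) := by
  funext x
  rw [pd_pd hη, partialDeriv, iteratedFDeriv_two_apply]

namespace IsTest
variable {f g : E d → ℝ}

lemma pd (hf : IsTest f) (i : Fin d) : IsTest (pd i f) :=
  ⟨contDiff_pd hf.1 i, HasCompactSupport.pd hf.2 i⟩

lemma smooth_mul (hf : IsTest f) (hg : ContDiff ℝ ∞ g) : IsTest (fun x => g x * f x) :=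
  ⟨hg.mul hf.1, hf.2.mul_left⟩

lemma add (hf : IsTest f) (hg : IsTest g) : IsTest (fun x => f x + g x) :=
  ⟨hf.1.add hg.1, hf.2.add hg.2⟩

lemma const_mul (hf : IsTest f) (c : ℝ) : IsTest (fun x => c * f x) :=
  hf.smooth_mul contDiff_const

lemma sub (hf : IsTest f) (hg : IsTest g) : IsTest (fun x => f x - g x) :=
  ⟨hf.1.sub hg.1, hf.2.sub hg.2⟩

lemma neg (hf : IsTest f) : IsTest (fun x => - f x) :=
  ⟨hf.1.neg, hf.2.neg⟩

lemma zero : IsTest (fun _ : E d => 0) := ⟨contDiff_const, HasCompactSupport.zero⟩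

lemma sum {ι : Type*} (s : Finset ι) {F : ι → E d → ℝ} (hF : ∀ i ∈ s, IsTest (F i)) :
    IsTest (fun x => ∑ i ∈ s, F i x) := by
  classical
  induction s using Finset.induction_on with
  | empty => simpa using zero
  | insert a s ha ih =>
    simp only [Finset.sum_insert ha]
    exact (hF a (by simp)).add (ih fun i hi => hF i (by simp [hi]))

lemma integrable (hf : IsTest f) : Integrable f :=
  hf.1.continuous.integrable_of_hasCompactSupport hf.2

lemma memLp (hf : IsTest f) {p : ℝ≥0∞} {ν : Measure (E d)} [IsFiniteMeasureOnCompacts ν] :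
    MemLp f p ν := hf.1.continuous.memLp_of_hasCompactSupport hf.2

end IsTest

/-- Integration by parts against a test function. -/
lemma integral_mul_pd {f g : E d → ℝ} (hf : ContDiff ℝ ∞ f) (hg : IsTest g) (i : Fin d) :
    ∫ x, f x * pd i g x = - ∫ x, pd i f x * g x :=
  integral_mul_fderiv_eq_neg_fderiv_mul_of_integrable
    (hg.smooth_mul (contDiff_pd hf i)).integrable
    ((hg.pd i).smooth_mul hf).integrable (hg.smooth_mul hf).integrable
    (fun x _ => (hf.differentiable (by simp)) x) (fun x _ => (hg.1.differentiable (by simp)) x)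

/-! ### Convergence in `L²` -/

/-- Convergence of functions in `L²(ν)`; the functions are required to lie in `L²(ν)`. -/
def L2Lim {X : Type*} [MeasurableSpace X] (ν : Measure X) (F : ℕ → X → ℝ) (f : X → ℝ) : Prop :=
  ∃ (hF : ∀ n, MemLp (F n) 2 ν) (hf : MemLp f 2 ν),
    Tendsto (fun n => (hF n).toLp (F n)) atTop (𝓝 (hf.toLp f))

section L2Lim
variable {X : Type*} [MeasurableSpace X] {ν : Measure X} {F G : ℕ → X → ℝ} {f g : X → ℝ}

lemma lpNorm_eq_norm_toLp (hf : MemLp f 2 ν) : lpNorm f 2 ν = ‖hf.toLp f‖ := by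
  rw [Lp.norm_toLp, toReal_eLpNorm hf.1]

lemma lpNorm_sq_eq_integral (hf : MemLp f 2 ν) : lpNorm f 2 ν ^ 2 = ∫ x, f x ^ 2 ∂ν := by
  rw [lpNorm_eq_norm_toLp hf, ← real_inner_self_eq_norm_sq, L2.inner_def]
  apply integral_congr_ae
  filter_upwards [hf.coeFn_toLp] with x hx
  rw [hx]; simp [sq]

lemma inner_toLp_eq_integral (hf : MemLp f 2 ν) (hg : MemLp g 2 ν) :
    inner ℝ (hf.toLp f) (hg.toLp g) = ∫ x, f x * g x ∂ν := by
  rw [L2.inner_def]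
  apply integral_congr_ae
  filter_upwards [hf.coeFn_toLp, hg.coeFn_toLp] with x hx hy
  rw [hx, hy]; simp [mul_comm]

lemma abs_integral_mul_le (hf : MemLp f 2 ν) (hg : MemLp g 2 ν) :
    |∫ x, f x * g x ∂ν| ≤ lpNorm f 2 ν * lpNorm g 2 ν := by
  rw [← inner_toLp_eq_integral hf hg, lpNorm_eq_norm_toLp hf, lpNorm_eq_norm_toLp hg]
  exact abs_real_inner_le_norm _ _

lemma lpNorm_congr_ae (h : f =ᵐ[ν] g) : lpNorm f 2 ν = lpNorm g 2 ν := by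
  classical
  simp only [lpNorm, eLpNorm_congr_ae h]
  exact if_congr (aestronglyMeasurable_congr h) rfl rfl

lemma lpNorm_le_of_integral_sq_le {Y : Type*} [MeasurableSpace Y] {ν' : Measure Y} {g : Y → ℝ}
    (hf : MemLp f 2 ν) (hg : MemLp g 2 ν')
    {C : ℝ} (hC : 0 ≤ C) (h : ∫ x, f x ^ 2 ∂ν ≤ C ^ 2 * ∫ x, g x ^ 2 ∂ν') :
    lpNorm f 2 ν ≤ C * lpNorm g 2 ν' := by
  rw [← lpNorm_sq_eq_integral hf, ← lpNorm_sq_eq_integral hg, ← mul_pow] at h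
  exact le_of_sq_le_sq h (mul_nonneg hC lpNorm_nonneg)

lemma memLp_bdd_mul {a : X → ℝ} {C : ℝ} (hf : MemLp f 2 ν) (ha : AEStronglyMeasurable a ν)
    (hC : ∀ x, |a x| ≤ C) : MemLp (fun x => a x * f x) 2 ν := by
  refine hf.of_le_mul (c := C) (ha.mul hf.1) (Eventually.of_forall fun x => ?_)
  rw [norm_mul]
  gcongr
  exact hC x

namespace L2Lim

lemma memLp (h : L2Lim ν F f) (n : ℕ) : MemLp (F n) 2 ν := h.1 n
lemma memLp_lim (h : L2Lim ν F f) : MemLp f 2 ν := h.2.1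

lemma of_lpNorm (hF : ∀ n, MemLp (F n) 2 ν) (hf : MemLp f 2 ν)
    (h : Tendsto (fun n => lpNorm (fun x => F n x - f x) 2 ν) atTop (𝓝 0)) : L2Lim ν F f := by
  refine ⟨hF, hf, ?_⟩
  rw [tendsto_iff_norm_sub_tendsto_zero]
  refine h.congr fun n => ?_
  rw [← MemLp.toLp_sub, ← lpNorm_eq_norm_toLp]
  rfl

lemma tendsto_lpNorm_sub (h : L2Lim ν F f) :
    Tendsto (fun n => lpNorm (fun x => F n x - f x) 2 ν) atTop (𝓝 0) := by
  obtain ⟨hF, hf, h⟩ := h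
  rw [tendsto_iff_norm_sub_tendsto_zero] at h
  refine h.congr fun n => ?_
  rw [← MemLp.toLp_sub, ← lpNorm_eq_norm_toLp]
  rfl

lemma congr_lim (h : L2Lim ν F f) (hfg : f =ᵐ[ν] g) : L2Lim ν F g := by
  obtain ⟨hF, hf, h⟩ := h
  refine ⟨hF, hf.ae_eq hfg, ?_⟩
  rwa [← (MemLp.toLp_eq_toLp_iff hf (hf.ae_eq hfg)).2 hfg]

lemma congr (h : L2Lim ν F f) (hFG : ∀ n, F n =ᵐ[ν] G n) : L2Lim ν G f := by
  obtain ⟨hF, hf, h⟩ := h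
  refine ⟨fun n => (hF n).ae_eq (hFG n), hf, h.congr fun n => ?_⟩
  exact (MemLp.toLp_eq_toLp_iff _ _).2 (hFG n)

lemma unique (h : L2Lim ν F f) (h' : L2Lim ν F g) : f =ᵐ[ν] g := by
  obtain ⟨hF, hf, h⟩ := h
  obtain ⟨hF', hg, h'⟩ := h'
  exact (MemLp.toLp_eq_toLp_iff hf hg).1 (tendsto_nhds_unique h h')

lemma add (h : L2Lim ν F f) (h' : L2Lim ν G g) :
    L2Lim ν (fun n x => F n x + G n x) (fun x => f x + g x) :=
  ⟨fun n => (h.1 n).add (h'.1 n), h.2.1.add h'.2.1, h.2.2.add h'.2.2⟩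

lemma const_mul (h : L2Lim ν F f) (c : ℝ) :
    L2Lim ν (fun n x => c * F n x) (fun x => c * f x) :=
  ⟨fun n => (h.1 n).const_mul c, h.2.1.const_mul c, h.2.2.const_smul c⟩

lemma neg (h : L2Lim ν F f) : L2Lim ν (fun n x => - F n x) (fun x => - f x) :=
  ⟨fun n => (h.1 n).neg, h.2.1.neg, h.2.2.neg⟩

lemma sub (h : L2Lim ν F f) (h' : L2Lim ν G g) :
    L2Lim ν (fun n x => F n x - G n x) (fun x => f x - g x) :=
  ⟨fun n => (h.1 n).sub (h'.1 n), h.2.1.sub h'.2.1, h.2.2.sub h'.2.2⟩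

lemma zero : L2Lim ν (fun _ _ => 0) (fun _ => 0) :=
  ⟨fun _ => MemLp.zero, MemLp.zero, tendsto_const_nhds⟩

lemma sum {ι : Type*} (s : Finset ι) {F : ι → ℕ → X → ℝ} {f : ι → X → ℝ}
    (h : ∀ i ∈ s, L2Lim ν (F i) (f i)) :
    L2Lim ν (fun n x => ∑ i ∈ s, F i n x) (fun x => ∑ i ∈ s, f i x) := by
  classical
  induction s using Finset.induction_on with
  | empty => simpa using zero
  | insert a s ha ih =>
    simp only [Finset.sum_insert ha]
    exact (h a (by simp)).add (ih fun i hi => h i (by simp [hi]))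

lemma tendsto_lpNorm (h : L2Lim ν F f) :
    Tendsto (fun n => lpNorm (F n) 2 ν) atTop (𝓝 (lpNorm f 2 ν)) := by
  obtain ⟨hF, hf, h⟩ := h
  rw [lpNorm_eq_norm_toLp hf]
  exact h.norm.congr fun n => (lpNorm_eq_norm_toLp (hF n)).symm

lemma tendsto_integral_mul (h : L2Lim ν F f) (h' : L2Lim ν G g) :
    Tendsto (fun n => ∫ x, F n x * G n x ∂ν) atTop (𝓝 (∫ x, f x * g x ∂ν)) := by
  obtain ⟨hF, hf, h⟩ := h
  obtain ⟨hG, hg, h'⟩ := h'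
  rw [← inner_toLp_eq_integral hf hg]
  exact (h.inner h').congr fun n => inner_toLp_eq_integral (hF n) (hG n)

lemma const (hf : MemLp f 2 ν) : L2Lim ν (fun _ => f) f := ⟨fun _ => hf, hf, tendsto_const_nhds⟩

/-- A sequence whose differences are dominated in norm by those of an `L²`-convergent sequence
converges. -/
lemma exists_of_le {Y : Type*} [MeasurableSpace Y] {ν' : Measure Y} {G : ℕ → Y → ℝ} {g : Y → ℝ}
    (hG : L2Lim ν' G g) (hF : ∀ n, MemLp (F n) 2 ν) (C : ℝ)
    (h : ∀ n m, lpNorm (fun x => F n x - F m x) 2 ν ≤ C * lpNorm (fun x => G n x - G m x) 2 ν') :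
    ∃ f, L2Lim ν F f := by
  obtain ⟨hG, hg, hlim⟩ := hG
  have hc : CauchySeq fun n => (hF n).toLp (F n) := by
    have hGc := hlim.cauchySeq
    rw [Metric.cauchySeq_iff] at hGc ⊢
    intro ε hε
    obtain ⟨N, hN⟩ := hGc (ε / (|C| + 1)) (by positivity)
    refine ⟨N, fun m hm n hn => ?_⟩
    have h1 := hN m hm n hn
    rw [dist_eq_norm, ← MemLp.toLp_sub, ← lpNorm_eq_norm_toLp] at h1 ⊢
    rw [lt_div_iff₀ (by positivity)] at h1
    calc _ ≤ C * lpNorm (fun x => G m x - G n x) 2 ν' := h m n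
      _ ≤ (|C| + 1) * lpNorm (fun x => G m x - G n x) 2 ν' := by
          have := le_abs_self C
          gcongr
          · exact lpNorm_nonneg
          · linarith
      _ < ε := by rw [mul_comm]; exact h1
  obtain ⟨f, hf⟩ := cauchySeq_tendsto_of_complete hc
  refine ⟨f, hF, Lp.memLp f, ?_⟩
  rwa [Lp.toLp_coeFn]

/-- Multiplication by uniformly bounded, pointwise convergent factors preserves the limit. -/
lemma mul_of_bounded (hf : MemLp f 2 ν) {A : ℕ → X → ℝ} {a : X → ℝ} {C : ℝ}
    (hA : ∀ n, AEStronglyMeasurable (A n) ν) (hC : ∀ n x, |A n x| ≤ C)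
    (ha : ∀ x, Tendsto (fun n => A n x) atTop (𝓝 (a x))) :
    L2Lim ν (fun n x => A n x * f x) (fun x => a x * f x) := by
  have haC : ∀ x, |a x| ≤ C := fun x => le_of_tendsto (ha x).abs (Eventually.of_forall (hC · x))
  have ham : AEStronglyMeasurable a ν :=
    aestronglyMeasurable_of_tendsto_ae atTop hA (Eventually.of_forall ha)
  have h1 : ∀ n, MemLp (fun x => A n x * f x) 2 ν := fun n =>
    memLp_bdd_mul hf (hA n) (hC n)
  have h2 : MemLp (fun x => a x * f x) 2 ν := memLp_bdd_mul hf ham haC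
  refine of_lpNorm h1 h2 ?_
  have h3 : Tendsto (fun n => lpNorm (fun x => A n x * f x - a x * f x) 2 ν ^ 2) atTop (𝓝 0) := by
    have : ∀ n, lpNorm (fun x => A n x * f x - a x * f x) 2 ν ^ 2 =
        ∫ x, (A n x * f x - a x * f x) ^ 2 ∂ν := fun n =>
      lpNorm_sq_eq_integral ((h1 n).sub h2)
    simp only [this]
    have h0 : (0 : ℝ) = ∫ x, (0 : ℝ) ∂ν := by simp
    rw [h0]
    apply tendsto_integral_of_dominated_convergence (fun x => (2 * C) ^ 2 * f x ^ 2)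
    · exact fun n => (((h1 n).sub h2).1).pow 2
    · exact hf.integrable_sq.const_mul _
    · intro n
      refine Eventually.of_forall fun x => ?_
      rw [← sub_mul, mul_pow, Real.norm_eq_abs, abs_mul, abs_of_nonneg (sq_nonneg (f x)),
        abs_of_nonneg (sq_nonneg _)]
      gcongr ?_ * _
      apply sq_le_sq'
      · linarith [neg_abs_le (A n x), le_abs_self (a x), hC n x, haC x]
      · linarith [le_abs_self (A n x), neg_abs_le (a x), hC n x, haC x]
    · refine Eventually.of_forall fun x => ?_
      have := (((ha x).sub_const (a x)).mul_const (f x)).pow 2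
      simpa [sub_mul] using this
  have h4 := h3.sqrt
  simpa [Real.sqrt_sq lpNorm_nonneg] using h4

end L2Lim
end L2Lim

/-! ### The weighted measure -/

lemma Z_pos (hd : 1 ≤ d) : 0 < Z d := by
  have h : (0 : ℝ) < d := by exact_mod_cast hd
  have := Real.Gamma_pos_of_pos (half_pos h)
  unfold Z sphereArea
  positivity

lemma measurable_density (d : ℕ) :
    Measurable fun x : E d => ENNReal.ofReal (Real.exp (‖x‖ ^ 2 / 4) / Z d) := by
  fun_prop

lemma ae_mu (hd : 1 ≤ d) : ae (mu d) = ae (volume : Measure (E d)) := by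
  apply le_antisymm
  · exact (withDensity_absolutelyContinuous _ _).ae_le
  · refine (withDensity_absolutelyContinuous' (measurable_density d).aemeasurable ?_).ae_le
    refine Eventually.of_forall fun x => ?_
    have := Z_pos hd
    simp only [ne_eq, ENNReal.ofReal_eq_zero, not_le]
    positivity

lemma aestronglyMeasurable_mu_iff (hd : 1 ≤ d) {f : E d → ℝ} :
    AEStronglyMeasurable f (mu d) ↔ AEStronglyMeasurable f volume :=
  ⟨fun h => h.mono_ac (Measure.ae_le_iff_absolutelyContinuous.1 (ae_mu hd).ge),
    fun h => h.mono_ac (withDensity_absolutelyContinuous _ _)⟩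

lemma density_eq (hd : 1 ≤ d) (x : E d) :
    (ENNReal.ofReal (Real.exp (‖x‖ ^ 2 / 4) / Z d)).toReal = (Z d)⁻¹ * gauss d (1 / 4) x := by
  have := Z_pos hd
  rw [ENNReal.toReal_ofReal (by positivity), gauss]
  field_simp

lemma integral_mu (hd : 1 ≤ d) (f : E d → ℝ) :
    ∫ x, f x ∂(mu d) = (Z d)⁻¹ * ∫ x, gauss d (1 / 4) x * f x := by
  rw [mu, integral_withDensity_eq_integral_toReal_smul (measurable_density d)
    (Eventually.of_forall fun x => by simp), ← integral_const_mul]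
  refine integral_congr_ae (Eventually.of_forall fun x => ?_)
  simp only [density_eq hd, smul_eq_mul, mul_assoc]

lemma memLp_mu_iff (hd : 1 ≤ d) {f : E d → ℝ} :
    MemLp f 2 (mu d) ↔ MemLp (fun x => gauss d (1 / 8) x * f x) 2 volume := by
  have hc := (contDiff_gauss (d := d) (1 / 8)).continuous
  have hc' := (contDiff_gauss (d := d) (-(1 / 8))).continuous
  have hm : AEStronglyMeasurable f (mu d) ↔
      AEStronglyMeasurable (fun x => gauss d (1 / 8) x * f x) volume := by
    rw [aestronglyMeasurable_mu_iff hd]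
    refine ⟨fun h => hc.aestronglyMeasurable.mul h, fun h => ?_⟩
    refine (hc'.aestronglyMeasurable.mul h).congr (Eventually.of_forall fun x => ?_)
    simp only [Pi.mul_apply]
    rw [← mul_assoc, gauss_mul]
    simp [gauss_zero]
  have key : AEStronglyMeasurable f (mu d) →
      (MemLp f 2 (mu d) ↔ MemLp (fun x => gauss d (1 / 8) x * f x) 2 volume) := by
    intro h
    rw [memLp_two_iff_integrable_sq h, memLp_two_iff_integrable_sq (hm.1 h), mu,
      integrable_withDensity_iff_integrable_smul' (measurable_density d)
        (Eventually.of_forall fun x => by simp)]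
    have h1 : (fun x => (ENNReal.ofReal (Real.exp (‖x‖ ^ 2 / 4) / Z d)).toReal • f x ^ 2) =
        fun x => (Z d)⁻¹ * (gauss d (1 / 8) x * f x) ^ 2 := by
      funext x
      rw [density_eq hd, mul_pow, sq (gauss _ _ _), gauss_mul, smul_eq_mul, mul_assoc]
      norm_num
    rw [h1, integrable_const_mul_iff (IsUnit.mk0 _ (inv_ne_zero (Z_pos hd).ne'))]
  exact ⟨fun h => (key h.1).1 h, fun h => (key (hm.2 h.1)).2 h⟩

lemma lpNorm_gauss_mul (hd : 1 ≤ d) {f : E d → ℝ} (hf : MemLp f 2 (mu d)) :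
    lpNorm (fun x => gauss d (1 / 8) x * f x) 2 volume = √(Z d) * lpNorm f 2 (mu d) := by
  have hZ := Z_pos hd
  have h1 := lpNorm_sq_eq_integral hf
  have h2 := lpNorm_sq_eq_integral ((memLp_mu_iff hd).1 hf)
  rw [integral_mu hd] at h1
  have h3 : ∀ x, (gauss d (1 / 8) x * f x) ^ 2 = gauss d (1 / 4) x * f x ^ 2 := by
    intro x
    rw [mul_pow, sq (gauss _ _ _), gauss_mul]; norm_num
  simp only [h3] at h2
  rw [← Real.sqrt_sq (lpNorm_nonneg (f := f)), h1, ← Real.sqrt_mul hZ.le,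
    mul_inv_cancel_left₀ hZ.ne', ← h2, Real.sqrt_sq lpNorm_nonneg]

lemma IsTest.memLp_mu (hd : 1 ≤ d) {f : E d → ℝ} (hf : IsTest f) : MemLp f 2 (mu d) :=
  (memLp_mu_iff hd).2 (hf.smooth_mul (contDiff_gauss _)).memLp

lemma L2Lim.gauss_mul (hd : 1 ≤ d) {F : ℕ → E d → ℝ} {f : E d → ℝ} (h : L2Lim (mu d) F f) :
    L2Lim volume (fun n x => gauss d (1 / 8) x * F n x) (fun x => gauss d (1 / 8) x * f x) := by
  refine L2Lim.of_lpNorm (fun n => (memLp_mu_iff hd).1 (h.memLp n))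
    ((memLp_mu_iff hd).1 h.memLp_lim) ?_
  have := h.tendsto_lpNorm_sub.const_mul (√(Z d))
  rw [mul_zero] at this
  refine this.congr fun n => ?_
  have h2 := lpNorm_gauss_mul hd ((h.memLp n).sub h.memLp_lim)
  simp only [Pi.sub_apply, mul_sub] at h2
  exact h2.symm

/-! ### Weak derivatives of first order -/

lemma LocallyIntegrable.smooth_mul {f a : E d → ℝ} (hf : LocallyIntegrable f volume)
    (ha : ContDiff ℝ ∞ a) : LocallyIntegrable (fun x => a x * f x) volume := by
  rw [← locallyIntegrableOn_univ] at hf ⊢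
  exact hf.continuousOn_mul ha.continuous.continuousOn isOpen_univ.isLocallyClosed

lemma integrable_mul_test {f η : E d → ℝ} (hf : LocallyIntegrable f volume)
    (hη : IsTest η) : Integrable (fun x => f x * η x) volume :=
  hf.integrable_smul_right_of_hasCompactSupport hη.1.continuous hη.2

lemma locallyIntegrable_of_memLp_mu (hd : 1 ≤ d) {f : E d → ℝ} (hf : MemLp f 2 (mu d)) :
    LocallyIntegrable f volume := by
  have h := LocallyIntegrable.smooth_mul (((memLp_mu_iff hd).1 hf).locallyIntegrable (by norm_num))
    (contDiff_gauss (-(1 / 8)))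
  convert h using 2 with x
  rw [← mul_assoc, WeightedSobolev.gauss_mul]
  simp [gauss_zero]

lemma L2Lim.tendsto_integral_test (hd : 1 ≤ d) {F : ℕ → E d → ℝ} {f ψ : E d → ℝ}
    (hF : L2Lim (mu d) F f) (hψ : IsTest ψ) :
    Tendsto (fun n => ∫ x, F n x * ψ x) atTop (𝓝 (∫ x, f x * ψ x)) := by
  have hid : ∀ (a : E d → ℝ) (x : E d),
      gauss d (1 / 8) x * a x * (gauss d (-(1 / 8)) x * ψ x) = a x * ψ x := by
    intro a x
    rw [mul_mul_mul_comm, WeightedSobolev.gauss_mul]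
    simp [gauss_zero]
  have h1 := (hF.gauss_mul hd).tendsto_integral_mul
    (L2Lim.const (hψ.smooth_mul (contDiff_gauss (-(1 / 8)))).memLp)
  simpa only [hid] using h1

/-- `g` is the weak derivative `∂_i f`. -/
def WD (i : Fin d) (f g : E d → ℝ) : Prop :=
  LocallyIntegrable f volume ∧ LocallyIntegrable g volume ∧
    ∀ η : E d → ℝ, IsTest η → ∫ x, f x * pd i η x = - ∫ x, g x * η x

lemma ae_eq_of_forall_test {f g : E d → ℝ} (hf : LocallyIntegrable f volume)
    (hg : LocallyIntegrable g volume)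
    (h : ∀ η : E d → ℝ, IsTest η → ∫ x, f x * η x = ∫ x, g x * η x) : f =ᵐ[volume] g := by
  refine ae_eq_of_integral_contDiff_smul_eq hf hg fun η h1 h2 => ?_
  simpa [mul_comm] using h η ⟨h1, h2⟩

lemma hasWeakDeriv_unique {k : ℕ} {α : Fin k → Fin d} {f g g' : E d → ℝ}
    (h : HasWeakDeriv α f g) (h' : HasWeakDeriv α f g') : g =ᵐ[volume] g' := by
  refine ae_eq_of_forall_test h.2.1 h'.2.1 fun η hη => ?_
  have := (h.2.2 η hη.1 hη.2).symm.trans (h'.2.2 η hη.1 hη.2)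
  exact mul_left_cancel₀ (pow_ne_zero _ (by norm_num)) this

lemma weakDeriv_ae_eq {k : ℕ} {α : Fin k → Fin d} {f g : E d → ℝ}
    (h : HasWeakDeriv α f g) : weakDeriv α f =ᵐ[volume] g := by
  have hex : ∃ g, HasWeakDeriv α f g := ⟨g, h⟩
  rw [weakDeriv, dif_pos hex]
  exact hasWeakDeriv_unique hex.choose_spec h

lemma hasWeakDeriv_zero {α : Fin 0 → Fin d} {f : E d → ℝ} (hf : LocallyIntegrable f volume) :
    HasWeakDeriv α f f :=
  ⟨hf, hf, fun η _ _ => by simp [partialDeriv_zero]⟩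

lemma hasWeakDeriv_one {α : Fin 1 → Fin d} {f g : E d → ℝ} :
    HasWeakDeriv α f g ↔ WD (α 0) f g := by
  simp only [HasWeakDeriv, WD, partialDeriv_one, IsTest, and_imp, pow_one, neg_mul, one_mul]

/-- Second order weak derivatives are iterated first order weak derivatives, once the inner
first derivative exists. -/
lemma hasWeakDeriv_two {α : Fin 2 → Fin d} {f g h : E d → ℝ} (hg : WD (α 1) f g) :
    HasWeakDeriv α f h ↔ WD (α 0) g h := by
  have key : ∀ η : E d → ℝ, IsTest η →
      ∫ x, f x * partialDeriv α η x = - ∫ x, g x * pd (α 0) η x := by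
    intro η hη
    rw [partialDeriv_two α hη.1, pd_comm hη.1, hg.2.2 _ (hη.pd _)]
  constructor
  · rintro ⟨-, h2, h3⟩
    refine ⟨hg.2.1, h2, fun η hη => ?_⟩
    have := h3 η hη.1 hη.2
    rw [key η hη] at this
    linarith
  · rintro ⟨-, h2, h3⟩
    refine ⟨hg.1, h2, fun η h4 h5 => ?_⟩
    rw [key η ⟨h4, h5⟩, h3 η ⟨h4, h5⟩]
    simp

namespace WD
variable {i : Fin d} {f g f' g' : E d → ℝ}

lemma congr (h : WD i f g) (hf : f =ᵐ[volume] f') (hg : g =ᵐ[volume] g') : WD i f' g' := by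
  refine ⟨h.1.congr hf, h.2.1.congr hg, fun η hη => ?_⟩
  have h1 : ∫ x, f' x * pd i η x = ∫ x, f x * pd i η x :=
    integral_congr_ae (by filter_upwards [hf] with x hx; rw [hx])
  have h2 : ∫ x, g' x * η x = ∫ x, g x * η x :=
    integral_congr_ae (by filter_upwards [hg] with x hx; rw [hx])
  rw [h1, h2, h.2.2 η hη]

lemma of_smooth (hf : ContDiff ℝ ∞ f) (i : Fin d) : WD i f (pd i f) :=
  ⟨hf.continuous.locallyIntegrable, (contDiff_pd hf i).continuous.locallyIntegrable,
    fun _ hη => integral_mul_pd hf hη i⟩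

lemma add (h : WD i f g) (h' : WD i f' g') :
    WD i (fun x => f x + f' x) (fun x => g x + g' x) := by
  refine ⟨h.1.add h'.1, h.2.1.add h'.2.1, fun η hη => ?_⟩
  simp only [add_mul]
  rw [integral_add (integrable_mul_test h.1 (hη.pd i)) (integrable_mul_test h'.1 (hη.pd i)),
    integral_add (integrable_mul_test h.2.1 hη) (integrable_mul_test h'.2.1 hη),
    h.2.2 η hη, h'.2.2 η hη]
  ring

lemma const_mul (h : WD i f g) (c : ℝ) : WD i (fun x => c * f x) (fun x => c * g x) := by
  refine ⟨h.1.smul c, h.2.1.smul c, fun η hη => ?_⟩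
  simp only [mul_assoc, integral_const_mul, h.2.2 η hη]
  ring

/-- The product rule for a smooth and a weakly differentiable factor. -/
lemma smooth_mul (h : WD i f g) {a : E d → ℝ} (ha : ContDiff ℝ ∞ a) :
    WD i (fun x => a x * f x) (fun x => a x * g x + pd i a x * f x) := by
  have hpa := contDiff_pd ha i
  refine ⟨LocallyIntegrable.smooth_mul h.1 ha, (LocallyIntegrable.smooth_mul h.2.1 ha).add
    (LocallyIntegrable.smooth_mul h.1 hpa), fun η hη => ?_⟩
  have h1 := h.2.2 _ (hη.smooth_mul ha)
  rw [pd_mul ha hη.1] at h1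
  have e1 : ∫ x, f x * (pd i a x * η x + a x * pd i η x) =
      (∫ x, f x * (pd i a x * η x)) + ∫ x, f x * (a x * pd i η x) := by
    rw [← integral_add (integrable_mul_test h.1 (hη.smooth_mul hpa))
      (integrable_mul_test h.1 ((hη.pd i).smooth_mul ha))]
    simp only [mul_add]
  have e2 : ∫ x, (a x * g x + pd i a x * f x) * η x =
      (∫ x, g x * (a x * η x)) + ∫ x, f x * (pd i a x * η x) := by
    rw [← integral_add (integrable_mul_test h.2.1 (hη.smooth_mul ha))
      (integrable_mul_test h.1 (hη.smooth_mul hpa))]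
    congr 1; funext x; ring
  have e3 : ∫ x, a x * f x * pd i η x = ∫ x, f x * (a x * pd i η x) := by
    congr 1; funext x; ring
  rw [e1] at h1
  rw [e2, e3]
  linarith

/-- The weak derivative is a closed operator in `L²(ℝ^d)`. -/
lemma of_L2Lim {F G : ℕ → E d → ℝ} (hF : L2Lim volume F f) (hG : L2Lim volume G g)
    (h : ∀ n, WD i (F n) (G n)) : WD i f g := by
  refine ⟨hF.memLp_lim.locallyIntegrable (by norm_num),
    hG.memLp_lim.locallyIntegrable (by norm_num), fun η hη => ?_⟩
  have h1 := hF.tendsto_integral_mul (L2Lim.const (hη.pd i).memLp)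
  have h2 := (hG.tendsto_integral_mul (L2Lim.const hη.memLp)).neg
  exact tendsto_nhds_unique h1 (h2.congr fun n => ((h n).2.2 η hη).symm)

/-- The weak derivative is a closed operator in `L²(μ)`. -/
lemma of_L2Lim_mu (hd : 1 ≤ d) {F G : ℕ → E d → ℝ} (hF : L2Lim (mu d) F f)
    (hG : L2Lim (mu d) G g) (h : ∀ n, WD i (F n) (G n)) : WD i f g := by
  refine ⟨locallyIntegrable_of_memLp_mu hd hF.memLp_lim,
    locallyIntegrable_of_memLp_mu hd hG.memLp_lim, fun η hη => ?_⟩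
  have h1 := hF.tendsto_integral_test hd (hη.pd i)
  have h2 := (hG.tendsto_integral_test hd hη).neg
  exact tendsto_nhds_unique h1 (h2.congr fun n => ((h n).2.2 η hη).symm)

end WD

/-! ### Mollification -/

/-- A mollifier of radius `δ`: a nonnegative test function of integral one, supported in the
ball of radius `δ`. -/
structure IsMollifier (δ : ℝ) (ρ : E d → ℝ) : Prop where
  isTest : IsTest ρ
  nonneg : ∀ x, 0 ≤ ρ x
  integral_eq : ∫ x, ρ x = 1
  eq_zero : ∀ x, δ ≤ ‖x‖ → ρ x = 0

lemma exists_isMollifier {δ : ℝ} (hδ : 0 < δ) : ∃ ρ : E d → ℝ, IsMollifier δ ρ := by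
  let φ : ContDiffBump (0 : E d) := ⟨δ / 2, δ, by positivity, by linarith⟩
  refine ⟨φ.normed volume, ⟨φ.contDiff_normed, φ.hasCompactSupport_normed⟩,
    φ.nonneg_normed, φ.integral_normed, fun x hx => ?_⟩
  by_contra h
  have : x ∈ Function.support (φ.normed volume) := h
  rw [φ.support_normed_eq, Metric.mem_ball, dist_zero_right] at this
  exact absurd this (not_lt.2 hx)

/-- The mollification `f ⋆ ρ`. -/
noncomputable def moll (ρ f : E d → ℝ) (x : E d) : ℝ := ∫ t, f t * ρ (x - t)

lemma moll_eq_convolution (ρ f : E d → ℝ) :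
    moll ρ f = convolution f ρ (ContinuousLinearMap.mul ℝ ℝ) volume := rfl

lemma contDiff_moll {ρ f : E d → ℝ} (hρ : IsTest ρ) (hf : LocallyIntegrable f volume) :
    ContDiff ℝ ∞ (moll ρ f) :=
  hρ.2.contDiff_convolution_right (ContinuousLinearMap.mul ℝ ℝ) hf hρ.1

lemma pd_moll {ρ f : E d → ℝ} (hρ : IsTest ρ) (hf : LocallyIntegrable f volume) (i : Fin d) :
    pd i (moll ρ f) = moll (pd i ρ) f := by
  funext x
  have h := hρ.2.hasFDerivAt_convolution_right (ContinuousLinearMap.mul ℝ ℝ) hf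
    (contDiff_infty.1 hρ.1 1) x
  have hc : HasCompactSupport (fderiv ℝ ρ) := hρ.2.fderiv (𝕜 := ℝ)
  rw [pd, moll_eq_convolution, h.fderiv, convolution_precompR_apply _ hf hc
    (contDiff_infty.1 hρ.1 1 |>.continuous_fderiv (by simp))]
  rfl

lemma IsTest.comp_sub_left {ρ : E d → ℝ} (hρ : IsTest ρ) (x : E d) :
    IsTest (fun t => ρ (x - t)) :=
  ⟨hρ.1.comp (contDiff_const.sub contDiff_id),
    hρ.2.comp_homeomorph (Homeomorph.subLeft x)⟩

/-- Mollification commutes with weak differentiation. -/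
lemma WD.pd_moll {ρ f g : E d → ℝ} {i : Fin d} (h : WD i f g) (hρ : IsTest ρ) :
    pd i (moll ρ f) = moll ρ g := by
  rw [WeightedSobolev.pd_moll hρ h.1]
  funext x
  have h1 := h.2.2 _ (hρ.comp_sub_left x)
  rw [pd_comp_sub_left hρ.1] at h1
  simp only [mul_neg, integral_neg, neg_inj] at h1
  exact h1

lemma integrable_sq_sub_mul {f ρ : E d → ℝ} (hf : LocallyIntegrable f volume)
    (hf2 : LocallyIntegrable (fun x => f x ^ 2) volume) (hρ : IsTest ρ) (c : ℝ) (x : E d) :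
    Integrable (fun t => (f t - c) ^ 2 * ρ (x - t)) := by
  have hη := hρ.comp_sub_left x
  have : (fun t => (f t - c) ^ 2 * ρ (x - t)) = fun t =>
      f t ^ 2 * ρ (x - t) - 2 * c * (f t * ρ (x - t)) + c ^ 2 * ρ (x - t) := by
    funext t; ring
  rw [this]
  exact ((integrable_mul_test hf2 hη).sub ((integrable_mul_test hf hη).const_mul _)).add
    (hη.integrable.const_mul _)

lemma IsMollifier.integral_sub_left {δ : ℝ} {ρ : E d → ℝ} (hρ : IsMollifier δ ρ) (x : E d) :
    ∫ t, ρ (x - t) = 1 := by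
  rw [integral_sub_left_eq_self ρ volume x, hρ.integral_eq]

/-- Jensen's inequality for the average defining the mollification. -/
lemma IsMollifier.sq_moll_sub_le {δ : ℝ} {ρ f : E d → ℝ} (hρ : IsMollifier δ ρ)
    (hf : LocallyIntegrable f volume) (hf2 : LocallyIntegrable (fun x => f x ^ 2) volume)
    (c : ℝ) (x : E d) : (moll ρ f x - c) ^ 2 ≤ ∫ t, (f t - c) ^ 2 * ρ (x - t) := by
  have hη := hρ.isTest.comp_sub_left x
  set m := moll ρ f x with hm
  have h0 : 0 ≤ ∫ t, (f t - m) ^ 2 * ρ (x - t) :=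
    integral_nonneg fun t => mul_nonneg (sq_nonneg _) (hρ.nonneg _)
  have h1 : ∫ t, (f t - c) ^ 2 * ρ (x - t) = (∫ t, (f t - m) ^ 2 * ρ (x - t)) +
      (2 * (m - c) * ∫ t, f t * ρ (x - t)) + (c ^ 2 - m ^ 2) * ∫ t, ρ (x - t) := by
    have i1 := integrable_sq_sub_mul hf hf2 hρ.isTest m x
    have i2 := (integrable_mul_test hf hη).const_mul (2 * (m - c))
    have i3 := hη.integrable.const_mul (c ^ 2 - m ^ 2)
    rw [← integral_const_mul, ← integral_const_mul, ← integral_add i1 i2]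
    refine Eq.trans ?_ (integral_add (i1.add i2) i3)
    congr 1; funext t; ring
  rw [h1, hρ.integral_sub_left, show ∫ t, f t * ρ (x - t) = m from rfl]
  nlinarith

/-- Translation is continuous in `L²`. -/
lemma exists_lintegral_translate_le {f : E d → ℝ} (hf : MemLp f 2 volume) {ε : ℝ} (hε : 0 < ε) :
    ∃ δ > 0, ∀ y : E d, ‖y‖ < δ →
      ∫⁻ x, ENNReal.ofReal ((f (x - y) - f x) ^ 2) ≤ ENNReal.ofReal (ε ^ 2) := by
  have hp : Fact ((2 : ℝ≥0∞) ≠ ⊤) := ⟨by simp⟩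
  let Φ : E d → Lp ℝ 2 (volume : Measure (E d)) := fun y => DomAddAct.mk (-y) +ᵥ hf.toLp f
  have hc : Continuous Φ := by
    have : Continuous fun y : E d => DomAddAct.mk (-y) :=
      DomAddAct.continuous_mk.comp continuous_neg
    exact this.vadd continuous_const
  have h0 : Φ 0 = hf.toLp f := by simp [Φ]
  obtain ⟨δ, hδ, h⟩ := Metric.continuous_iff.1 hc 0 ε hε
  refine ⟨δ, hδ, fun y hy => ?_⟩
  have h1 := h y (by simpa using hy)
  have hfy : MemLp (fun x => f (-y +ᵥ x)) 2 volume :=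
    hf.comp_measurePreserving (measurePreserving_vadd (-y) volume)
  rw [h0, show Φ y = hfy.toLp _ from DomAddAct.mk_vadd_toLp (-y) hf, dist_eq_norm,
    ← MemLp.toLp_sub, ← lpNorm_eq_norm_toLp] at h1
  have h2 := lpNorm_sq_eq_integral (hfy.sub hf)
  have h3 : ∫ x, (f (x - y) - f x) ^ 2 ≤ ε ^ 2 := by
    calc _ = lpNorm ((fun x => f (-y +ᵥ x)) - f) 2 volume ^ 2 := by
          rw [h2]
          congr 1; funext x
          simp [vadd_eq_add, sub_eq_neg_add]
      _ ≤ ε ^ 2 := by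
          have := lpNorm_nonneg (f := (fun x => f (-y +ᵥ x)) - f) (p := 2) (μ := volume)
          gcongr
  rw [← ofReal_integral_eq_lintegral_ofReal]
  · exact ENNReal.ofReal_le_ofReal h3
  · have := (hfy.sub hf).integrable_sq
    refine this.congr (Eventually.of_forall fun x => ?_)
    simp [vadd_eq_add, sub_eq_neg_add]
  · exact Eventually.of_forall fun x => sq_nonneg _

lemma memLp_and_lpNorm_le_of_lintegral {X : Type*} [MeasurableSpace X] {ν : Measure X} {g : X → ℝ}
    (hg : AEStronglyMeasurable g ν) {ε : ℝ} (hε : 0 ≤ ε)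
    (h : ∫⁻ x, ENNReal.ofReal (g x ^ 2) ∂ν ≤ ENNReal.ofReal (ε ^ 2)) :
    MemLp g 2 ν ∧ lpNorm g 2 ν ≤ ε := by
  have h1 : MemLp g 2 ν := by
    rw [memLp_two_iff_integrable_sq hg]
    refine ⟨hg.pow 2, ?_⟩
    rw [hasFiniteIntegral_iff_ofReal (Eventually.of_forall fun x => sq_nonneg _)]
    exact h.trans_lt ENNReal.ofReal_lt_top
  refine ⟨h1, ?_⟩
  have h2 := lpNorm_sq_eq_integral h1
  rw [integral_eq_lintegral_of_nonneg_ae (Eventually.of_forall fun x => sq_nonneg _) (hg.pow 2)]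
    at h2
  have h3 := ENNReal.toReal_mono ENNReal.ofReal_ne_top h
  rw [← h2, ENNReal.toReal_ofReal (sq_nonneg _)] at h3
  exact le_of_sq_le_sq h3 hε

/-- Mollification with a small radius is a small perturbation in `L²`. -/
lemma exists_lpNorm_moll_sub_le {f : E d → ℝ} (hf : MemLp f 2 volume) {ε : ℝ} (hε : 0 < ε) :
    ∃ δ₀ > 0, ∀ δ ≤ δ₀, ∀ ρ : E d → ℝ, IsMollifier δ ρ → MemLp (moll ρ f) 2 volume ∧
      lpNorm (fun x => moll ρ f x - f x) 2 volume ≤ ε := by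
  obtain ⟨δ₀, hδ₀, h⟩ := exists_lintegral_translate_le hf hε
  refine ⟨δ₀, hδ₀, fun δ hδ ρ hρ => ?_⟩
  have hl : LocallyIntegrable f volume := hf.locallyIntegrable (by norm_num)
  have hl2 : LocallyIntegrable (fun x => f x ^ 2) volume := hf.integrable_sq.locallyIntegrable
  have hm : AEStronglyMeasurable (moll ρ f) volume :=
    (contDiff_moll hρ.isTest hl).continuous.aestronglyMeasurable
  have key : ∫⁻ x, ENNReal.ofReal ((moll ρ f x - f x) ^ 2) ≤ ENNReal.ofReal (ε ^ 2) := by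
    have hρm : Measurable ρ := hρ.isTest.1.continuous.measurable
    calc ∫⁻ x, ENNReal.ofReal ((moll ρ f x - f x) ^ 2)
        ≤ ∫⁻ x, ∫⁻ y, ENNReal.ofReal (ρ y) * ENNReal.ofReal ((f (x - y) - f x) ^ 2) := by
          apply lintegral_mono
          intro x
          dsimp only
          refine (ENNReal.ofReal_le_ofReal (hρ.sq_moll_sub_le hl hl2 (f x) x)).trans ?_
          rw [ofReal_integral_eq_lintegral_ofReal
            (integrable_sq_sub_mul hl hl2 hρ.isTest (f x) x)
            (Eventually.of_forall fun t => mul_nonneg (sq_nonneg _) (hρ.nonneg _)),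
            ← lintegral_sub_left_eq_self _ x]
          apply lintegral_mono
          intro y
          simp only [sub_sub_cancel]
          rw [← ENNReal.ofReal_mul (hρ.nonneg _), mul_comm]
      _ = ∫⁻ y, ∫⁻ x, ENNReal.ofReal (ρ y) * ENNReal.ofReal ((f (x - y) - f x) ^ 2) := by
          apply lintegral_lintegral_swap
          have h1 : AEStronglyMeasurable (fun p : E d × E d => f (p.1 - p.2))
              (volume.prod volume) :=
            hf.1.comp_quasiMeasurePreserving (quasiMeasurePreserving_sub volume volume)
          have h2 : AEStronglyMeasurable (fun p : E d × E d => f p.1) (volume.prod volume) :=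
            hf.1.comp_fst
          exact ((hρm.comp measurable_snd).ennreal_ofReal.aemeasurable).mul
            (((h1.sub h2).pow 2).aemeasurable.ennreal_ofReal)
      _ ≤ ∫⁻ y, ENNReal.ofReal (ρ y) * ENNReal.ofReal (ε ^ 2) := by
          apply lintegral_mono
          intro y
          dsimp only
          rw [lintegral_const_mul' _ _ ENNReal.ofReal_ne_top]
          by_cases hy : ‖y‖ < δ₀
          · gcongr
            exact h y hy
          · rw [hρ.eq_zero y (by linarith)]
            simp
      _ = ENNReal.ofReal (ε ^ 2) := by
          rw [lintegral_mul_const' _ _ ENNReal.ofReal_ne_top,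
            ← ofReal_integral_eq_lintegral_ofReal hρ.isTest.integrable
              (Eventually.of_forall hρ.nonneg), hρ.integral_eq]
          simp
  obtain ⟨h1, h2⟩ := memLp_and_lpNorm_le_of_lintegral (hm.sub hf.1) hε.le key
  refine ⟨?_, h2⟩
  have := h1.add hf
  simpa using this

/-! ### Density of the test functions -/

lemma hasCompactSupport_moll {ρ f : E d → ℝ} (hρ : HasCompactSupport ρ)
    (hf : HasCompactSupport f) : HasCompactSupport (moll ρ f) := by
  rw [moll_eq_convolution]
  exact HasCompactSupport.convolution (ContinuousLinearMap.mul ℝ ℝ) hf hρ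

/-- `u ∈ H²(ν)` with weak gradient `g` and weak Hessian `h`, where `h i j = ∂_i ∂_j u`. -/
structure IsH2 (ν : Measure (E d)) (u : E d → ℝ) (g : Fin d → E d → ℝ)
    (h : Fin d → Fin d → E d → ℝ) : Prop where
  memLp : MemLp u 2 ν
  memLp_grad : ∀ i, MemLp (g i) 2 ν
  memLp_hess : ∀ i j, MemLp (h i j) 2 ν
  grad : ∀ i, WD i u (g i)
  hess : ∀ i j, WD i (g j) (h i j)

lemma IsTest.exists_bound {f : E d → ℝ} (hf : IsTest f) : ∃ C, ∀ x, |f x| ≤ C :=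
  hf.2.exists_bound_of_continuous hf.1.continuous

/-- The dilated cutoff `x ↦ χ(x / (n + 1))`. -/
noncomputable def cutoff (χ : E d → ℝ) (n : ℕ) (x : E d) : ℝ := χ (((n : ℝ) + 1)⁻¹ • x)

lemma IsTest.cutoff {χ : E d → ℝ} (hχ : IsTest χ) (n : ℕ) : IsTest (cutoff χ n) := by
  have hn : ((n : ℝ) + 1)⁻¹ ≠ 0 := by positivity
  exact ⟨hχ.1.comp (contDiff_id.const_smul _),
    hχ.2.comp_homeomorph (Homeomorph.smulOfNeZero _ hn)⟩

lemma pd_cutoff {χ : E d → ℝ} (hχ : IsTest χ) (n : ℕ) (i : Fin d) :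
    pd i (cutoff χ n) = fun x => ((n : ℝ) + 1)⁻¹ * cutoff (pd i χ) n x :=
  pd_comp_const_smul hχ.1 _ i

lemma pd_pd_cutoff {χ : E d → ℝ} (hχ : IsTest χ) (n : ℕ) (i j : Fin d) :
    pd i (pd j (cutoff χ n)) =
      fun x => ((n : ℝ) + 1)⁻¹ * (((n : ℝ) + 1)⁻¹ * cutoff (pd i (pd j χ)) n x) := by
  rw [pd_cutoff hχ, pd_const_mul ((hχ.pd j).cutoff n).1, pd_cutoff (hχ.pd j)]

lemma tendsto_inv_succ : Tendsto (fun n : ℕ => ((n : ℝ) + 1)⁻¹) atTop (𝓝 0) := by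
  simpa [one_div] using tendsto_one_div_add_atTop_nhds_zero_nat (𝕜 := ℝ)

lemma tendsto_cutoff {χ : E d → ℝ} (hχ : IsTest χ) (x : E d) :
    Tendsto (fun n => cutoff χ n x) atTop (𝓝 (χ 0)) := by
  have h : Tendsto (fun n : ℕ => ((n : ℝ) + 1)⁻¹ • x) atTop (𝓝 0) := by
    simpa using tendsto_inv_succ.smul_const x
  exact (hχ.1.continuous.tendsto 0).comp h

lemma L2Lim.cutoff_mul {ν : Measure (E d)} {χ f : E d → ℝ} (hχ : IsTest χ) (hf : MemLp f 2 ν) :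
    L2Lim ν (fun n x => cutoff χ n x * f x) (fun x => χ 0 * f x) := by
  obtain ⟨C, hC⟩ := hχ.exists_bound
  exact L2Lim.mul_of_bounded hf (fun n => (hχ.cutoff n).1.continuous.aestronglyMeasurable)
    (fun n x => hC _) (tendsto_cutoff hχ)

lemma L2Lim.inv_mul {X : Type*} [MeasurableSpace X] {ν : Measure X} {F : ℕ → X → ℝ} {f : X → ℝ}
    (h : L2Lim ν F f) : L2Lim ν (fun n x => ((n : ℝ) + 1)⁻¹ * F n x) (fun _ => 0) := by
  refine ⟨fun n => (h.memLp n).const_mul _, MemLp.zero, ?_⟩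
  have := tendsto_inv_succ.smul h.2.2
  rw [zero_smul] at this
  exact this

lemma L2Lim.pd_cutoff_mul {ν : Measure (E d)} {χ f : E d → ℝ} (hχ : IsTest χ) (hf : MemLp f 2 ν)
    (i : Fin d) : L2Lim ν (fun n x => pd i (cutoff χ n) x * f x) (fun _ => 0) := by
  have := (L2Lim.cutoff_mul (hχ.pd i) hf).inv_mul
  simpa only [pd_cutoff hχ, mul_assoc] using this

lemma L2Lim.pd_pd_cutoff_mul {ν : Measure (E d)} {χ f : E d → ℝ} (hχ : IsTest χ)
    (hf : MemLp f 2 ν) (i j : Fin d) :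
    L2Lim ν (fun n x => pd i (pd j (cutoff χ n)) x * f x) (fun _ => 0) := by
  have := (L2Lim.cutoff_mul ((hχ.pd j).pd i) hf).inv_mul.inv_mul
  simpa only [pd_pd_cutoff hχ, mul_assoc] using this

lemma exists_cutoff (d : ℕ) : ∃ χ : E d → ℝ, IsTest χ ∧ χ 0 = 1 := by
  let φ : ContDiffBump (0 : E d) := ⟨1, 2, one_pos, one_lt_two⟩
  exact ⟨φ, ⟨φ.contDiff, φ.hasCompactSupport⟩, φ.one_of_mem_closedBall (by simp [φ.rIn_pos.le])⟩

/-- On functions supported in a ball the norm of `L²(μ)` is dominated by that of `L²(ℝ^d)`. -/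
lemma memLp_mu_of_eq_zero (hd : 1 ≤ d) {f : E d → ℝ} (hf : MemLp f 2 volume) {R : ℝ}
    (hR : ∀ x, R < ‖x‖ → f x = 0) :
    MemLp f 2 (mu d) ∧
      lpNorm f 2 (mu d) ≤ (√(Z d))⁻¹ * (Real.exp (R ^ 2 / 8) * lpNorm f 2 volume) := by
  have hb : ∀ x, |gauss d (1 / 8) x * f x| ≤ Real.exp (R ^ 2 / 8) * |f x| := by
    intro x
    rw [abs_mul, abs_of_pos (gauss_pos _ _)]
    by_cases hx : R < ‖x‖
    · simp [hR x hx]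
    · gcongr
      rw [gauss]
      gcongr
      have : ‖x‖ ^ 2 ≤ R ^ 2 := by
        have := norm_nonneg x
        gcongr
        exact not_lt.1 hx
      linarith
  have h1 : MemLp (fun x => gauss d (1 / 8) x * f x) 2 volume :=
    hf.of_le_mul ((contDiff_gauss _).continuous.aestronglyMeasurable.mul hf.1)
      (Eventually.of_forall hb)
  have h2 := (memLp_mu_iff hd).2 h1
  refine ⟨h2, ?_⟩
  have hs : 0 < √(Z d) := Real.sqrt_pos.2 (Z_pos hd)
  rw [← div_eq_inv_mul, le_div_iff₀ hs, mul_comm, ← lpNorm_gauss_mul hd h2]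
  refine lpNorm_le_of_integral_sq_le h1 hf (Real.exp_pos _).le ?_
  rw [← integral_const_mul]
  refine integral_mono h1.integrable_sq (hf.integrable_sq.const_mul _) fun x => ?_
  simp only [← mul_pow]
  rw [sq_le_sq, abs_mul (Real.exp _), abs_of_pos (Real.exp_pos _)]
  exact hb x

/-- Mollification is a small perturbation in `L²(μ)` of compactly supported functions, since the
density of `μ` is locally bounded. -/
lemma eventually_lpNorm_moll_sub_le (hd : 1 ≤ d) {f : E d → ℝ} (hf : MemLp f 2 (mu d))
    (hc : HasCompactSupport f) {ε : ℝ} (hε : 0 < ε) :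
    ∀ᶠ δ in 𝓝[>] (0 : ℝ), ∀ ρ : E d → ℝ, IsMollifier δ ρ →
      MemLp (fun x => moll ρ f x - f x) 2 (mu d) ∧
        lpNorm (fun x => moll ρ f x - f x) 2 (mu d) ≤ ε := by
  obtain ⟨R, hR⟩ := hc.isCompact.isBounded.exists_norm_le
  have hf0 : ∀ x, R < ‖x‖ → f x = 0 := fun x hx => by
    by_contra h
    exact absurd (hR x (subset_tsupport f h)) (not_le.2 hx)
  have hfv : MemLp f 2 volume := by
    refine ((memLp_mu_iff hd).1 hf).of_le ((aestronglyMeasurable_mu_iff hd).1 hf.1)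
      (Eventually.of_forall fun x => ?_)
    rw [norm_mul, Real.norm_eq_abs (gauss _ _ _), abs_of_pos (gauss_pos _ _)]
    refine le_mul_of_one_le_left (norm_nonneg _) ?_
    rw [gauss]
    exact Real.one_le_exp (by positivity)
  have hs : 0 < √(Z d) := Real.sqrt_pos.2 (Z_pos hd)
  obtain ⟨δ₀, hδ₀, h⟩ := exists_lpNorm_moll_sub_le hfv
    (ε := √(Z d) * ((Real.exp ((R + 1) ^ 2 / 8))⁻¹ * ε)) (by positivity)
  filter_upwards [Ioc_mem_nhdsGT (lt_min hδ₀ one_pos)] with δ hδ ρ hρ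
  obtain ⟨h1, h2⟩ := h δ (hδ.2.trans (min_le_left _ _)) ρ hρ
  have hz : ∀ x, R + 1 < ‖x‖ → moll ρ f x - f x = 0 := by
    intro x hx
    rw [hf0 x (by linarith), sub_zero, moll]
    refine integral_eq_zero_of_ae (Eventually.of_forall fun t => ?_)
    by_cases ht : R < ‖t‖
    · simp [hf0 t ht]
    · have : δ ≤ ‖x - t‖ := by
        have := norm_sub_norm_le x t
        have := hδ.2.trans (min_le_right _ _)
        linarith
      simp [hρ.eq_zero _ this]
  obtain ⟨h3, h4⟩ := memLp_mu_of_eq_zero hd (h1.sub hfv) hz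
  refine ⟨h3, h4.trans ?_⟩
  rw [inv_mul_le_iff₀ hs, ← le_inv_mul_iff₀ (Real.exp_pos _)]
  refine h2.trans (le_of_eq ?_)
  ring

/-- Test functions are dense in `H²(μ)`: truncate, then mollify. -/
theorem IsH2.exists_test_approx (hd : 1 ≤ d) {u : E d → ℝ} {g : Fin d → E d → ℝ}
    {h : Fin d → Fin d → E d → ℝ} (hu : IsH2 (mu d) u g h) :
    ∃ η : ℕ → E d → ℝ, (∀ n, IsTest (η n)) ∧ L2Lim (mu d) η u ∧
      (∀ i, L2Lim (mu d) (fun n => pd i (η n)) (g i)) ∧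
      ∀ i j, L2Lim (mu d) (fun n => pd i (pd j (η n))) (h i j) := by
  obtain ⟨χ, hχ, hχ0⟩ := exists_cutoff d
  -- the truncations and their weak derivatives
  let w : ℕ → E d → ℝ := fun n x => cutoff χ n x * u x
  let wg : Fin d → ℕ → E d → ℝ := fun i n x => cutoff χ n x * g i x + pd i (cutoff χ n) x * u x
  let wh : Fin d → Fin d → ℕ → E d → ℝ := fun i j n x =>
    (cutoff χ n x * h i j x + pd i (cutoff χ n) x * g j x) +
      (pd j (cutoff χ n) x * g i x + pd i (pd j (cutoff χ n)) x * u x)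
  have lw : L2Lim (mu d) w u := by simpa [hχ0] using L2Lim.cutoff_mul hχ hu.memLp
  have lwg : ∀ i, L2Lim (mu d) (wg i) (g i) := fun i => by
    simpa [hχ0] using
      (L2Lim.cutoff_mul hχ (hu.memLp_grad i)).add (L2Lim.pd_cutoff_mul hχ hu.memLp i)
  have lwh : ∀ i j, L2Lim (mu d) (wh i j) (h i j) := fun i j => by
    simpa [hχ0] using
      ((L2Lim.cutoff_mul hχ (hu.memLp_hess i j)).add
        (L2Lim.pd_cutoff_mul hχ (hu.memLp_grad j) i)).add
      ((L2Lim.pd_cutoff_mul hχ (hu.memLp_grad i) j).add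
        (L2Lim.pd_pd_cutoff_mul hχ hu.memLp i j))
  have dw : ∀ n i, WD i (w n) (wg i n) := fun n i => (hu.grad i).smooth_mul (hχ.cutoff n).1
  have dwg : ∀ n i j, WD i (wg j n) (wh i j n) := fun n i j =>
    ((hu.hess i j).smooth_mul (hχ.cutoff n).1).add
      ((hu.grad i).smooth_mul ((hχ.cutoff n).pd j).1)
  have cw : ∀ n, HasCompactSupport (w n) := fun n => (hχ.cutoff n).2.mul_right
  have cwg : ∀ n i, HasCompactSupport (wg i n) := fun n i =>
    (hχ.cutoff n).2.mul_right.add ((hχ.cutoff n).pd i).2.mul_right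
  have cwh : ∀ n i j, HasCompactSupport (wh i j n) := fun n i j =>
    ((hχ.cutoff n).2.mul_right.add ((hχ.cutoff n).pd i).2.mul_right).add
      (((hχ.cutoff n).pd j).2.mul_right.add (((hχ.cutoff n).pd j).pd i).2.mul_right)
  have ex : ∀ n : ℕ, ∃ ρ : E d → ℝ, IsTest ρ ∧
      (MemLp (fun x => moll ρ (w n) x - w n x) 2 (mu d) ∧
        lpNorm (fun x => moll ρ (w n) x - w n x) 2 (mu d) ≤ ((n : ℝ) + 1)⁻¹) ∧
      (∀ i, MemLp (fun x => moll ρ (wg i n) x - wg i n x) 2 (mu d) ∧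
        lpNorm (fun x => moll ρ (wg i n) x - wg i n x) 2 (mu d) ≤ ((n : ℝ) + 1)⁻¹) ∧
      ∀ i j, MemLp (fun x => moll ρ (wh i j n) x - wh i j n x) 2 (mu d) ∧
        lpNorm (fun x => moll ρ (wh i j n) x - wh i j n x) 2 (mu d) ≤ ((n : ℝ) + 1)⁻¹ := by
    intro n
    have hε : 0 < ((n : ℝ) + 1)⁻¹ := by positivity
    have e1 := eventually_lpNorm_moll_sub_le hd (lw.memLp n) (cw n) hε
    have e2 := eventually_all.2 fun i =>
      eventually_lpNorm_moll_sub_le hd ((lwg i).memLp n) (cwg n i) hε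
    have e3 := eventually_all.2 fun i => eventually_all.2 fun j =>
      eventually_lpNorm_moll_sub_le hd ((lwh i j).memLp n) (cwh n i j) hε
    obtain ⟨δ, ⟨⟨h1, h2⟩, h3⟩, hδ⟩ := ((e1.and e2).and e3 |>.and self_mem_nhdsWithin).exists
    obtain ⟨ρ, hρ⟩ := exists_isMollifier (d := d) hδ
    exact ⟨ρ, hρ.isTest, h1 ρ hρ, fun i => h2 i ρ hρ, fun i j => h3 i j ρ hρ⟩
  choose ρ hρ r0 r1 r2 using ex
  have lim : ∀ (F G : ℕ → E d → ℝ) (f : E d → ℝ), L2Lim (mu d) F f →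
      (∀ n : ℕ, MemLp (fun x => G n x - F n x) 2 (mu d) ∧
        lpNorm (fun x => G n x - F n x) 2 (mu d) ≤ ((n : ℝ) + 1)⁻¹) → L2Lim (mu d) G f := by
    intro F G f hF hG
    have : L2Lim (mu d) (fun n x => G n x - F n x) (fun _ => 0) := by
      refine L2Lim.of_lpNorm (fun n => (hG n).1) MemLp.zero ?_
      simp only [sub_zero]
      exact squeeze_zero (fun n => lpNorm_nonneg) (fun n => (hG n).2) tendsto_inv_succ
    simpa using this.add hF
  have p1 : ∀ n i, pd i (moll (ρ n) (w n)) = moll (ρ n) (wg i n) := fun n i =>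
    (dw n i).pd_moll (hρ n)
  have p2 : ∀ n i j, pd i (pd j (moll (ρ n) (w n))) = moll (ρ n) (wh i j n) := fun n i j => by
    rw [p1, (dwg n i j).pd_moll (hρ n)]
  refine ⟨fun n => moll (ρ n) (w n), fun n => ⟨?_, ?_⟩, lim _ _ _ lw r0, fun i => ?_,
    fun i j => ?_⟩
  · exact contDiff_moll (hρ n) (locallyIntegrable_of_memLp_mu hd (lw.memLp n))
  · exact hasCompactSupport_moll (hρ n).2 (cw n)
  · simp only [p1]
    exact lim _ _ _ (lwg i) fun n => r1 n i
  · simp only [p2]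
    exact lim _ _ _ (lwh i j) fun n => r2 n i j

/-! ### A priori estimates for test functions -/

instance isLocallyFiniteMeasure_mu : IsLocallyFiniteMeasure (mu d) :=
  IsLocallyFiniteMeasure.withDensity_ofReal (by fun_prop)

lemma IsTest.integrable_of_isLocallyFinite {ν : Measure (E d)} [IsLocallyFiniteMeasure ν]
    {f : E d → ℝ} (hf : IsTest f) : Integrable f ν :=
  hf.1.continuous.integrable_of_hasCompactSupport hf.2

/-- Integration by parts in `L²(μ)`: the adjoint of `∂_i` is `-(∂_i + x_i / 2)`. -/
lemma integral_pd_mul_mu (hd : 1 ≤ d) {f g : E d → ℝ} (hf : ContDiff ℝ ∞ f) (hg : IsTest g)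
    (i : Fin d) :
    ∫ x, pd i f x * g x ∂(mu d) = - ∫ x, f x * (pd i g x + x i / 2 * g x) ∂(mu d) := by
  have h := integral_mul_pd hf (hg.smooth_mul (contDiff_gauss (1 / 4))) i
  rw [pd_mul (contDiff_gauss _) hg.1, pd_gauss] at h
  rw [integral_mu hd, integral_mu hd, ← mul_neg]
  congr 1
  calc ∫ x, gauss d (1 / 4) x * (pd i f x * g x)
      = ∫ x, pd i f x * (gauss d (1 / 4) x * g x) := by congr 1; funext x; ring
    _ = - ∫ x, f x * (2 * (1 / 4) * x i * gauss d (1 / 4) x * g x +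
          gauss d (1 / 4) x * pd i g x) := by rw [h, neg_neg]
    _ = _ := by congr 2; funext x; ring

/-- The operator `𝓛` with classical derivatives. -/
noncomputable def classicalL (u : E d → ℝ) (x : E d) : ℝ :=
  -(∑ i : Fin d, x i / 2 * pd i u x) - ∑ i : Fin d, pd i (pd i u) x

lemma IsTest.coord_mul {u : E d → ℝ} (hu : IsTest u) (i : Fin d) :
    IsTest (fun x => x i / 2 * u x) :=
  hu.smooth_mul ((contDiff_coord i).div_const 2)

lemma IsTest.classicalL {u : E d → ℝ} (hu : IsTest u) : IsTest (classicalL u) :=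
  (IsTest.sum _ fun i _ => (hu.pd i).coord_mul i).neg.sub
    (IsTest.sum _ fun i _ => (hu.pd i).pd i)

lemma IsTest.mul {f g : E d → ℝ} (hf : IsTest f) (hg : IsTest g) :
    IsTest (fun x => f x * g x) := hg.smooth_mul hf.1

/-- `𝓛 = ∑ ∂_i^* ∂_i` with adjoints in `L²(μ)`. -/
lemma integral_classicalL_mul (hd : 1 ≤ d) {u v : E d → ℝ} (hu : IsTest u) (hv : IsTest v) :
    ∫ x, classicalL u x * v x ∂(mu d) = ∑ i, ∫ x, pd i u x * pd i v x ∂(mu d) := by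
  have h : ∀ i, ∫ x, pd i u x * pd i v x ∂(mu d) =
      ∫ x, -(x i / 2 * pd i u x + pd i (pd i u) x) * v x ∂(mu d) := by
    intro i
    have := integral_pd_mul_mu hd hv.1 (hu.pd i) i
    calc _ = ∫ x, pd i v x * pd i u x ∂(mu d) := by congr 1; funext x; ring
      _ = _ := by rw [this, ← integral_neg]; congr 1; funext x; ring
  simp only [h]
  rw [← integral_finsetSum]
  · congr 1; funext x
    rw [← Finset.sum_mul, classicalL, Finset.sum_neg_distrib, Finset.sum_add_distrib]
    ring
  · intro i _
    exact ((((hu.pd i).coord_mul i).add ((hu.pd i).pd i)).neg.mul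
      hv).integrable_of_isLocallyFinite

lemma pd_finset_sum {ι : Type*} (s : Finset ι) {F : ι → E d → ℝ}
    (hF : ∀ k ∈ s, ContDiff ℝ ∞ (F k)) (i : Fin d) :
    pd i (fun x => ∑ k ∈ s, F k x) = fun x => ∑ k ∈ s, pd i (F k) x := by
  classical
  funext x
  simp only [pd]
  rw [fderiv_fun_sum fun k hk => ((hF k hk).differentiable (by simp)) x]
  simp

/-- The commutator relation `∂_i 𝓛 = 𝓛 ∂_i - ∂_i / 2`. -/
lemma pd_classicalL {u : E d → ℝ} (hu : IsTest u) (i : Fin d) :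
    pd i (classicalL u) = fun x => classicalL (pd i u) x - 1 / 2 * pd i u x := by
  have s1 : ∀ k ∈ Finset.univ, ContDiff ℝ ∞ (fun x : E d => x k / 2 * pd k u x) :=
    fun k _ => ((hu.pd k).coord_mul k).1
  have s2 : ∀ k ∈ Finset.univ, ContDiff ℝ ∞ (pd k (pd k u)) := fun k _ => ((hu.pd k).pd k).1
  have hc : ∀ k : Fin d, pd i (fun x : E d => x k / 2) = fun _ => if i = k then 1 / 2 else 0 := by
    intro k
    have := pd_const_mul (contDiff_coord k) (1 / 2) i
    rw [pd_coord] at this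
    calc _ = pd i (fun x : E d => 1 / 2 * x k) := by congr 1; funext x; ring
      _ = _ := by rw [this]; funext x; split_ifs <;> simp
  have e : classicalL u =
      fun x => (-1) * (∑ k, x k / 2 * pd k u x) - ∑ k, pd k (pd k u) x := by
    funext x; simp [classicalL]
  rw [e, pd_sub (contDiff_const.mul (ContDiff.sum s1)) (ContDiff.sum s2),
    pd_const_mul (ContDiff.sum s1), pd_finset_sum _ s1, pd_finset_sum _ s2]
  funext x
  have t1 : ∀ k, pd i (fun x : E d => x k / 2 * pd k u x) x =
      (if i = k then 1 / 2 * pd k u x else 0) + x k / 2 * pd k (pd i u) x := by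
    intro k
    rw [pd_mul ((contDiff_coord k).div_const 2) (hu.pd k).1, hc, pd_comm hu.1 i k]
    simp
  have t2 : ∀ k, pd i (pd k (pd k u)) x = pd k (pd k (pd i u)) x := by
    intro k
    rw [pd_comm (hu.pd k).1, pd_comm hu.1 i k]
  simp only [t1, t2, classicalL, Finset.sum_add_distrib, Finset.sum_ite_eq, Finset.mem_univ,
    if_true]
  ring

/-- The Bochner identity for `𝓛`. -/
lemma integral_classicalL_sq (hd : 1 ≤ d) {u : E d → ℝ} (hu : IsTest u) :
    ∫ x, classicalL u x ^ 2 ∂(mu d) =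
      (∑ i, ∑ j, ∫ x, pd i (pd j u) x ^ 2 ∂(mu d)) -
        1 / 2 * ∑ i, ∫ x, pd i u x ^ 2 ∂(mu d) := by
  have h := integral_classicalL_mul hd hu hu.classicalL
  simp only [← sq] at h
  rw [h, Finset.sum_comm, Finset.mul_sum, ← Finset.sum_sub_distrib]
  refine Finset.sum_congr rfl fun i _ => ?_
  have h2 := integral_classicalL_mul hd (hu.pd i) (hu.pd i)
  simp only [← sq] at h2
  rw [← h2, pd_classicalL hu, ← integral_const_mul, ← integral_sub]
  · congr 1; funext x; ring
  · exact ((hu.pd i).classicalL.mul (hu.pd i)).integrable_of_isLocallyFinite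
  · simp only [sq]
    exact (((hu.pd i).mul (hu.pd i)).const_mul _).integrable_of_isLocallyFinite

/-- A weighted Hardy–Poincaré inequality: the square `2 (∂_i v + x_i v / 4)²` has nonnegative
integral, and integrating its mixed term by parts produces the two terms on the left. -/
lemma hardy_poincare (hd : 1 ≤ d) {v : E d → ℝ} (hv : IsTest v) (i : Fin d) :
    1 / 2 * (∫ x, v x ^ 2 ∂(mu d)) + 1 / 8 * (∫ x, (x i * v x) ^ 2 ∂(mu d)) ≤
      2 * ∫ x, pd i v x ^ 2 ∂(mu d) := by
  have hxv : IsTest (fun x => x i * v x) := hv.smooth_mul (contDiff_coord i)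
  have h := integral_pd_mul_mu hd hv.1 hxv i
  rw [pd_mul (contDiff_coord i) hv.1, pd_coord] at h
  have i1 : Integrable (fun x => v x ^ 2) (mu d) := by
    simpa only [sq] using (hv.mul hv).integrable_of_isLocallyFinite
  have i2 : Integrable (fun x => (x i * v x) ^ 2) (mu d) := by
    simpa only [sq] using (hxv.mul hxv).integrable_of_isLocallyFinite
  have i3 : Integrable (fun x => pd i v x ^ 2) (mu d) := by
    simpa only [sq] using ((hv.pd i).mul (hv.pd i)).integrable_of_isLocallyFinite
  have i4 : Integrable (fun x => pd i v x * (x i * v x)) (mu d) :=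
    ((hv.pd i).mul hxv).integrable_of_isLocallyFinite
  have h1 : ∫ x, v x * (((if i = i then (1 : ℝ) else 0) * v x + x i * pd i v x) +
      x i / 2 * (x i * v x)) ∂(mu d) = (∫ x, v x ^ 2 ∂(mu d)) +
      (∫ x, pd i v x * (x i * v x) ∂(mu d)) + 1 / 2 * ∫ x, (x i * v x) ^ 2 ∂(mu d) := by
    rw [← integral_const_mul, ← integral_add i1 i4]
    refine Eq.trans ?_ (integral_add (i1.add i4) (i2.const_mul _))
    congr 1; funext x; simp; ring
  rw [h1] at h
  have h2 : 0 ≤ ∫ x, 2 * (pd i v x + x i * v x / 4) ^ 2 ∂(mu d) :=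
    integral_nonneg fun x => by positivity
  have h3 : ∫ x, 2 * (pd i v x + x i * v x / 4) ^ 2 ∂(mu d) =
      2 * (∫ x, pd i v x ^ 2 ∂(mu d)) + (∫ x, pd i v x * (x i * v x) ∂(mu d)) +
        1 / 8 * ∫ x, (x i * v x) ^ 2 ∂(mu d) := by
    rw [← integral_const_mul, ← integral_const_mul, ← integral_add (i3.const_mul _) i4]
    refine Eq.trans ?_ (integral_add ((i3.const_mul _).add i4) (i2.const_mul _))
    congr 1; funext x; ring
  rw [h3] at h2
  linarith

lemma integral_sq_nonneg {X : Type*} [MeasurableSpace X] (ν : Measure X) (f : X → ℝ) :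
    0 ≤ ∫ x, f x ^ 2 ∂ν := integral_nonneg fun _ => sq_nonneg _

lemma lpNorm_le_pd (hd : 1 ≤ d) {v : E d → ℝ} (hv : IsTest v) (i : Fin d) :
    lpNorm v 2 (mu d) ≤ 2 * lpNorm (pd i v) 2 (mu d) := by
  refine lpNorm_le_of_integral_sq_le hv.memLp (hv.pd i).memLp (by norm_num) ?_
  have := hardy_poincare hd hv i
  have := integral_sq_nonneg (mu d) fun x => x i * v x
  linarith

lemma lpNorm_coord_mul_le_pd (hd : 1 ≤ d) {v : E d → ℝ} (hv : IsTest v) (i : Fin d) :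
    lpNorm (fun x => x i * v x) 2 (mu d) ≤ 4 * lpNorm (pd i v) 2 (mu d) := by
  refine lpNorm_le_of_integral_sq_le (hv.smooth_mul (contDiff_coord i)).memLp (hv.pd i).memLp
    (by norm_num) ?_
  have := hardy_poincare hd hv i
  have := integral_sq_nonneg (mu d) v
  linarith

/-- Combines `‖∇u‖² = ⟨𝓛u, u⟩ ≤ ‖𝓛u‖ ‖u‖` with the Poincaré inequality `‖u‖ ≤ 2 ‖∂_i u‖`. -/
lemma lpNorm_pd_le_classicalL (hd : 1 ≤ d) {u : E d → ℝ} (hu : IsTest u) (i : Fin d) :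
    lpNorm (pd i u) 2 (mu d) ≤ 2 * lpNorm (classicalL u) 2 (mu d) := by
  have h1 := integral_classicalL_mul hd hu hu
  have h2 := (le_abs_self _).trans (abs_integral_mul_le (ν := mu d) hu.classicalL.memLp hu.memLp)
  simp only [← sq] at h1
  have h3 : lpNorm (pd i u) 2 (mu d) ^ 2 ≤ ∑ i, ∫ x, pd i u x ^ 2 ∂(mu d) := by
    rw [lpNorm_sq_eq_integral (hu.pd i).memLp]
    exact Finset.single_le_sum (f := fun i => ∫ x, pd i u x ^ 2 ∂(mu d))
      (fun j _ => integral_sq_nonneg _ _) (Finset.mem_univ i)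
  have h4 := lpNorm_le_pd hd hu i
  have h5 : 0 ≤ lpNorm (pd i u) 2 (mu d) := lpNorm_nonneg
  have h6 : 0 ≤ lpNorm (classicalL u) 2 (mu d) := lpNorm_nonneg
  rcases h5.eq_or_lt with h0 | h0
  · rw [← h0]; positivity
  · have h7 : lpNorm (pd i u) 2 (mu d) * lpNorm (pd i u) 2 (mu d) ≤
        2 * lpNorm (classicalL u) 2 (mu d) * lpNorm (pd i u) 2 (mu d) := by nlinarith
    exact le_of_mul_le_mul_right h7 h0

lemma lpNorm_le_classicalL (hd : 1 ≤ d) {u : E d → ℝ} (hu : IsTest u) :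
    lpNorm u 2 (mu d) ≤ 4 * lpNorm (classicalL u) 2 (mu d) := by
  have h1 := lpNorm_le_pd hd hu ⟨0, hd⟩
  have h2 := lpNorm_pd_le_classicalL hd hu ⟨0, hd⟩
  linarith

lemma lpNorm_pd_pd_le_classicalL (hd : 1 ≤ d) {u : E d → ℝ} (hu : IsTest u) (i j : Fin d) :
    lpNorm (pd i (pd j u)) 2 (mu d) ≤ (1 + d) * 2 * lpNorm (classicalL u) 2 (mu d) := by
  have h1 := integral_classicalL_sq hd hu
  have h2 : ∑ i, ∫ x, pd i u x ^ 2 ∂(mu d) ≤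
      ∑ _i : Fin d, 4 * ∫ x, classicalL u x ^ 2 ∂(mu d) := by
    refine Finset.sum_le_sum fun i _ => ?_
    have h3 := lpNorm_pd_le_classicalL hd hu i
    have h4 : lpNorm (pd i u) 2 (mu d) ^ 2 ≤ (2 * lpNorm (classicalL u) 2 (mu d)) ^ 2 := by
      have : 0 ≤ lpNorm (pd i u) 2 (mu d) := lpNorm_nonneg
      gcongr
    rw [mul_pow, lpNorm_sq_eq_integral (hu.pd i).memLp,
      lpNorm_sq_eq_integral hu.classicalL.memLp] at h4
    linarith
  have h5 : ∫ x, pd i (pd j u) x ^ 2 ∂(mu d) ≤ ∑ i, ∑ j, ∫ x, pd i (pd j u) x ^ 2 ∂(mu d) := by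
    refine (Finset.single_le_sum (f := fun j => ∫ x, pd i (pd j u) x ^ 2 ∂(mu d))
      (fun k _ => integral_sq_nonneg _ _) (Finset.mem_univ j)).trans ?_
    exact Finset.single_le_sum (f := fun i => ∑ j, ∫ x, pd i (pd j u) x ^ 2 ∂(mu d))
      (fun k _ => Finset.sum_nonneg fun l _ => integral_sq_nonneg _ _) (Finset.mem_univ i)
  simp only [Finset.sum_const, Finset.card_univ, Fintype.card_fin, nsmul_eq_mul] at h2
  refine lpNorm_le_of_integral_sq_le ((hu.pd j).pd i).memLp hu.classicalL.memLp
    (by positivity) ?_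
  have h6 := integral_sq_nonneg (mu d) (classicalL u)
  have h7 : (0 : ℝ) ≤ d := by positivity
  nlinarith [mul_nonneg h7 h6, mul_nonneg (mul_nonneg h7 h7) h6]

/-! ### The ground state transform -/

/-- The potential `|x|²/16 + d/4` of the Schrödinger operator conjugate to `𝓛`. -/
noncomputable def potential (d : ℕ) (x : E d) : ℝ := (∑ i, x i ^ 2) / 16 + d / 4

lemma contDiff_potential : ContDiff ℝ ∞ (potential d) := by
  unfold potential; fun_prop

lemma pd_potential (i : Fin d) : pd i (potential d) = fun x => x i / 8 := by
  have h1 : ∀ k ∈ Finset.univ, ContDiff ℝ ∞ (fun x : E d => x k * x k) := fun k _ =>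
    (contDiff_coord k).mul (contDiff_coord k)
  have e : potential d = fun x : E d => (1 / 16) * (∑ k, x k * x k) + d / 4 := by
    funext x; simp only [potential, sq]; ring
  have hconst : pd i (fun _ : E d => (d : ℝ) / 4) = fun _ => 0 := by
    funext x; simp [pd]
  rw [e, pd_add (contDiff_const.mul (ContDiff.sum h1)) contDiff_const,
    pd_const_mul (ContDiff.sum h1), pd_finset_sum _ h1, hconst]
  funext x
  have h2 : ∀ k, pd i (fun x : E d => x k * x k) x = if i = k then 2 * x k else 0 := by
    intro k
    rw [pd_mul (contDiff_coord k) (contDiff_coord k), pd_coord]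
    split_ifs <;> simp; ring
  simp only [h2, Finset.sum_ite_eq, Finset.mem_univ, if_true]
  ring

/-- The classical Laplacian. -/
noncomputable def lap (f : E d → ℝ) (x : E d) : ℝ := ∑ i : Fin d, pd i (pd i f) x

lemma IsTest.lap {f : E d → ℝ} (hf : IsTest f) : IsTest (lap f) :=
  IsTest.sum _ fun i _ => (hf.pd i).pd i

lemma pd_gauss_mul {u : E d → ℝ} (hu : ContDiff ℝ ∞ u) (c : ℝ) (i : Fin d) :
    pd i (fun x => gauss d c x * u x) =
      fun x => gauss d c x * (pd i u x + 2 * c * (x i * u x)) := by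
  rw [pd_mul (contDiff_gauss c) hu, pd_gauss]
  funext x; ring

lemma pd_pd_gauss_mul {u : E d → ℝ} (hu : ContDiff ℝ ∞ u) (c : ℝ) (i j : Fin d) (x : E d) :
    pd i (pd j (fun x => gauss d c x * u x)) x =
      gauss d c x * (pd i (pd j u) x + 2 * c * ((if i = j then 1 else 0) * u x + x j * pd i u x) +
        2 * c * (x i * (pd j u x + 2 * c * (x j * u x)))) := by
  have h1 : ContDiff ℝ ∞ fun x : E d => x j * u x := (contDiff_coord j).mul hu
  rw [pd_gauss_mul hu, pd_gauss_mul ((contDiff_pd hu j).add (contDiff_const.mul h1)),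
    pd_add (contDiff_pd hu j) (contDiff_const.mul h1), pd_const_mul h1,
    pd_mul (contDiff_coord j) hu, pd_coord]

/-- Conjugation by `e^{|x|²/8}` turns `𝓛` into the Schrödinger operator `-Δ + potential`. -/
lemma gauss_mul_classicalL {u : E d → ℝ} (hu : ContDiff ℝ ∞ u) (x : E d) :
    gauss d (1 / 8) x * classicalL u x =
      - lap (fun x => gauss d (1 / 8) x * u x) x +
        potential d x * (gauss d (1 / 8) x * u x) := by
  have h : lap (fun x => gauss d (1 / 8) x * u x) x = gauss d (1 / 8) x *
      ((∑ i, pd i (pd i u) x) + (d : ℝ) / 4 * u x + (∑ i, x i / 2 * pd i u x) +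
        (∑ i, x i ^ 2) / 16 * u x) := by
    have hd : ((d : ℝ) / 4 * u x) = ∑ _i : Fin d, 1 / 4 * u x := by simp; ring
    simp only [lap, pd_pd_gauss_mul hu]
    rw [← Finset.mul_sum, hd, Finset.sum_div, Finset.sum_mul, ← Finset.sum_add_distrib,
      ← Finset.sum_add_distrib, ← Finset.sum_add_distrib]
    congr 1
    refine Finset.sum_congr rfl fun i _ => ?_
    simp; ring
  rw [h, classicalL, potential]
  ring

/-- The Hessian and the Laplacian of a test function have the same `L²` norm. -/
lemma integral_lap_sq {f : E d → ℝ} (hf : IsTest f) :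
    ∫ x, lap f x ^ 2 = ∑ i, ∑ j, ∫ x, pd i (pd j f) x ^ 2 := by
  have h : ∀ i j, ∫ x, pd i (pd i f) x * pd j (pd j f) x = ∫ x, pd i (pd j f) x ^ 2 := by
    intro i j
    have h1 := integral_mul_pd (hf.pd i).1 ((hf.pd j).pd j) i
    have h2 := integral_mul_pd ((hf.pd i).pd j).1 ((hf.pd i).pd j) j
    have h3 := integral_mul_pd (hf.pd i).1 ((hf.pd j).pd i) j
    have c1 : pd i (pd j (pd j f)) = pd j (pd i (pd j f)) := pd_comm (hf.pd j).1 i j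
    have c2 : pd j (pd i f) = pd i (pd j f) := pd_comm hf.1 j i
    rw [c1] at h1
    rw [c2] at h3
    simp only [sq]
    linarith
  simp only [← h]
  have h1 : ∀ x, lap f x ^ 2 = ∑ i, ∑ j, pd i (pd i f) x * pd j (pd j f) x := by
    intro x
    rw [sq, lap, Finset.sum_mul_sum]
  simp only [h1]
  have hi : ∀ i j, Integrable fun x => pd i (pd i f) x * pd j (pd j f) x := fun i j =>
    (((hf.pd i).pd i).mul ((hf.pd j).pd j)).integrable
  rw [integral_finsetSum _ fun i _ => integrable_finsetSum _ fun j _ => hi i j]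
  refine Finset.sum_congr rfl fun i _ => ?_
  rw [integral_finsetSum _ fun j _ => hi i j]

/-- The Laplacian is dominated by the Schrödinger operator `-Δ + potential`. -/
lemma integral_lap_sq_le (hd : 1 ≤ d) {f : E d → ℝ} (hf : IsTest f) :
    ∫ x, lap f x ^ 2 ≤ ∫ x, (- lap f x + potential d x * f x) ^ 2 := by
  have hVf : IsTest fun x => potential d x * f x := hf.smooth_mul contDiff_potential
  have e : ∀ i, pd i (fun x => potential d x * f x) =
      fun x => x i / 8 * f x + potential d x * pd i f x := fun i => by
    rw [pd_mul contDiff_potential hf.1, pd_potential]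
  -- integration by parts in the mixed term
  have h1 : ∫ x, potential d x * f x * lap f x =
      - ∫ x, ∑ i, (x i / 8 * f x + potential d x * pd i f x) * pd i f x := by
    have h2 : ∀ i, ∫ x, potential d x * f x * pd i (pd i f) x =
        - ∫ x, (x i / 8 * f x + potential d x * pd i f x) * pd i f x := by
      intro i
      rw [integral_mul_pd hVf.1 (hf.pd i), e]
    have h3 : ∀ i, Integrable fun x => potential d x * f x * pd i (pd i f) x := fun i =>
      (hVf.mul ((hf.pd i).pd i)).integrable
    have h4 : ∀ i, Integrable fun x =>
        (x i / 8 * f x + potential d x * pd i f x) * pd i f x := fun i => by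
      have := ((hVf.pd i).mul (hf.pd i)).integrable
      rwa [e] at this
    rw [integral_finsetSum _ fun i _ => h4 i, ← Finset.sum_neg_distrib]
    simp only [← h2, lap, Finset.mul_sum]
    rw [integral_finsetSum _ fun i _ => h3 i]
  have hsq : Integrable fun x => lap f x ^ 2 := by
    simpa only [sq] using (hf.lap.mul hf.lap).integrable
  have hVsq : Integrable fun x => (potential d x * f x) ^ 2 := by
    simpa only [sq] using (hVf.mul hVf).integrable
  have hmix : Integrable fun x => potential d x * f x * lap f x := (hVf.mul hf.lap).integrable
  have hgr : Integrable fun x =>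
      ∑ i, (x i / 8 * f x + potential d x * pd i f x) * pd i f x := by
    refine integrable_finsetSum _ fun i _ => ?_
    have := ((hVf.pd i).mul (hf.pd i)).integrable
    rwa [e] at this
  have h5 : ∫ x, (- lap f x + potential d x * f x) ^ 2 = (∫ x, lap f x ^ 2) +
      ∫ x, ((potential d x * f x) ^ 2 +
        2 * ∑ i, (x i / 8 * f x + potential d x * pd i f x) * pd i f x) := by
    rw [integral_add hVsq (hgr.const_mul 2), integral_const_mul,
      ← neg_neg (∫ x, ∑ i, (x i / 8 * f x + potential d x * pd i f x) * pd i f x), ← h1,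
      ← integral_neg, ← integral_const_mul]
    have hmix' : Integrable fun x => 2 * -(potential d x * f x * lap f x) := hmix.neg.const_mul 2
    rw [← integral_add hVsq hmix']
    refine Eq.trans ?_ (integral_add hsq (hVsq.add hmix'))
    congr 1; funext x; ring
  rw [h5]
  refine le_add_of_nonneg_right (integral_nonneg fun x => ?_)
  -- the integrand is at least `½ ∑ (∂_i f + x_i f / 4)²` because `potential ≥ 1/4` and
  -- `potential² ≥ |x|²/32`
  dsimp only
  have hd' : (1 : ℝ) ≤ d := by exact_mod_cast hd
  have hs : 0 ≤ ∑ i, x i ^ 2 := Finset.sum_nonneg fun i _ => sq_nonneg _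
  have hV : 1 / 4 ≤ potential d x := by unfold potential; linarith
  have hV2 : (∑ i, x i ^ 2) / 32 ≤ potential d x ^ 2 := by
    unfold potential; nlinarith [mul_nonneg hs hs]
  have h6 : ∑ i, (1 / 2 * (pd i f x + x i / 4 * f x) ^ 2 - x i ^ 2 / 32 * f x ^ 2) ≤
      2 * ∑ i, (x i / 8 * f x + potential d x * pd i f x) * pd i f x := by
    rw [Finset.mul_sum]
    refine Finset.sum_le_sum fun i _ => ?_
    nlinarith [mul_le_mul_of_nonneg_right hV (sq_nonneg (pd i f x))]
  have h7 : 0 ≤ ∑ i, 1 / 2 * (pd i f x + x i / 4 * f x) ^ 2 :=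
    Finset.sum_nonneg fun i _ => by positivity
  rw [Finset.sum_sub_distrib, ← Finset.sum_mul, ← Finset.sum_div] at h6
  have h8 := mul_le_mul_of_nonneg_right hV2 (sq_nonneg (f x))
  rw [Pi.zero_apply, mul_pow]
  linarith

/-! ### Density of the range -/

lemma lap_comp_sub_left {ρ : E d → ℝ} (hρ : ContDiff ℝ ∞ ρ) (x t : E d) :
    lap (fun t => ρ (x - t)) t = lap ρ (x - t) := by
  have h : ∀ i, pd i (pd i fun t => ρ (x - t)) t = pd i (pd i ρ) (x - t) := by
    intro i
    have h1 : ContDiff ℝ ∞ fun y => pd i ρ (x - y) :=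
      (contDiff_pd hρ i).comp (contDiff_const.sub contDiff_id)
    have h2 := pd_const_mul h1 (-1) i
    simp only [neg_mul, one_mul] at h2
    rw [pd_comp_sub_left hρ, h2, pd_comp_sub_left (contDiff_pd hρ i)]
    simp
  simp only [lap, h]

lemma lap_moll {ρ f : E d → ℝ} (hρ : IsTest ρ) (hf : LocallyIntegrable f volume) (x : E d) :
    lap (moll ρ f) x = ∫ t, f t * lap (fun t => ρ (x - t)) t := by
  simp only [lap_comp_sub_left hρ.1]
  simp only [lap, pd_moll hρ hf, pd_moll (hρ.pd _) hf, Finset.mul_sum]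
  rw [integral_finsetSum]
  · rfl
  · exact fun i _ => integrable_mul_test hf (((hρ.pd i).pd i).comp_sub_left x)

/-- A Caccioppoli inequality. -/
lemma integral_sq_mul_lap_le {s χ : E d → ℝ} (hs : ContDiff ℝ ∞ s) (hχ : IsTest χ) :
    ∫ x, χ x * s x * (χ x * lap s x) ≤ ∑ i, ∫ x, pd i χ x * s x * (pd i χ x * s x) := by
  have hcs : IsTest fun x => χ x * (χ x * s x) := by
    have := (hχ.mul hχ).smooth_mul hs
    convert this using 2; ring
  have h1 : ∀ i, ∫ x, pd i (pd i s) x * (χ x * (χ x * s x)) ≤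
      ∫ x, pd i χ x * s x * (pd i χ x * s x) := by
    intro i
    have h2 := integral_mul_pd (contDiff_pd hs i) hcs i
    rw [← neg_eq_iff_eq_neg] at h2
    rw [← h2, ← integral_neg]
    have ht : IsTest fun x => pd i χ x * s x := by
      have := (hχ.pd i).smooth_mul hs
      convert this using 2; ring
    refine integral_mono ((hcs.pd i).smooth_mul (contDiff_pd hs i)).integrable.neg
      (ht.mul ht).integrable fun x => ?_
    have e : pd i (fun x => χ x * (χ x * s x)) x =
        2 * χ x * pd i χ x * s x + χ x ^ 2 * pd i s x := by
      rw [pd_mul hχ.1 (hχ.1.mul hs), pd_mul hχ.1 hs]; ring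
    dsimp only
    rw [e]
    nlinarith [sq_nonneg (χ x * pd i s x + pd i χ x * s x)]
  calc ∫ x, χ x * s x * (χ x * lap s x)
      = ∑ i, ∫ x, pd i (pd i s) x * (χ x * (χ x * s x)) := by
        rw [← integral_finsetSum]
        · congr 1; funext x
          rw [← Finset.sum_mul, lap]; ring
        · exact fun i _ => (hcs.smooth_mul (contDiff_pd (contDiff_pd hs i) i)).integrable
    _ ≤ _ := Finset.sum_le_sum fun i _ => h1 i

lemma L2Lim.bdd_mul {X : Type*} [MeasurableSpace X] {ν : Measure X} {F : ℕ → X → ℝ} {f a : X → ℝ}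
    (h : L2Lim ν F f) {C : ℝ} (ha : AEStronglyMeasurable a ν) (hC : ∀ x, |a x| ≤ C) :
    L2Lim ν (fun n x => a x * F n x) (fun x => a x * f x) := by
  refine L2Lim.of_lpNorm (fun n => memLp_bdd_mul (h.memLp n) ha hC)
    (memLp_bdd_mul h.memLp_lim ha hC) ?_
  have h1 := h.tendsto_lpNorm_sub.const_mul |C|
  rw [mul_zero] at h1
  refine squeeze_zero (fun n => lpNorm_nonneg) (fun n => ?_) h1
  have h2 : MemLp (fun x => F n x - f x) 2 ν := (h.memLp n).sub h.memLp_lim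
  simp only [← mul_sub]
  refine lpNorm_le_of_integral_sq_le (memLp_bdd_mul h2 ha hC) h2 (abs_nonneg C) ?_
  rw [← integral_const_mul]
  refine integral_mono (memLp_bdd_mul h2 ha hC).integrable_sq (h2.integrable_sq.const_mul _)
    fun x => ?_
  simp only [mul_pow, sq_abs]
  gcongr ?_ * _
  rw [sq_le_sq]
  exact (hC x).trans (le_abs_self C)

lemma exists_mollifier_seq {f g : E d → ℝ} (hf : MemLp f 2 volume) (hg : MemLp g 2 volume) :
    ∃ ρ : ℕ → E d → ℝ, (∀ n, IsMollifier 1 (ρ n)) ∧ L2Lim volume (fun n => moll (ρ n) f) f ∧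
      L2Lim volume (fun n => moll (ρ n) g) g := by
  have ex : ∀ n : ℕ, ∃ ρ : E d → ℝ, IsMollifier 1 ρ ∧
      (MemLp (moll ρ f) 2 volume ∧
        lpNorm (fun x => moll ρ f x - f x) 2 volume ≤ ((n : ℝ) + 1)⁻¹) ∧
      (MemLp (moll ρ g) 2 volume ∧
        lpNorm (fun x => moll ρ g x - g x) 2 volume ≤ ((n : ℝ) + 1)⁻¹) := by
    intro n
    have hε : 0 < ((n : ℝ) + 1)⁻¹ := by positivity
    obtain ⟨δ₁, h₁, H₁⟩ := exists_lpNorm_moll_sub_le hf hε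
    obtain ⟨δ₂, h₂, H₂⟩ := exists_lpNorm_moll_sub_le hg hε
    obtain ⟨ρ, hρ⟩ := exists_isMollifier (d := d) (lt_min one_pos (lt_min h₁ h₂))
    refine ⟨ρ, ⟨hρ.isTest, hρ.nonneg, hρ.integral_eq, fun x hx =>
      hρ.eq_zero x ((min_le_left _ _).trans hx)⟩, H₁ _ ?_ ρ hρ, H₂ _ ?_ ρ hρ⟩
    · exact (min_le_right _ _).trans (min_le_left _ _)
    · exact (min_le_right _ _).trans (min_le_right _ _)
  choose ρ hρ r1 r2 using ex
  exact ⟨ρ, hρ,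
    L2Lim.of_lpNorm (fun n => (r1 n).1) hf
      (squeeze_zero (fun n => lpNorm_nonneg) (fun n => (r1 n).2) tendsto_inv_succ),
    L2Lim.of_lpNorm (fun n => (r2 n).1) hg
      (squeeze_zero (fun n => lpNorm_nonneg) (fun n => (r2 n).2) tendsto_inv_succ)⟩

lemma one_quarter_le_potential (hd : 1 ≤ d) (x : E d) : 1 / 4 ≤ potential d x := by
  have hd' : (1 : ℝ) ≤ d := by exact_mod_cast hd
  have hs : 0 ≤ ∑ i, x i ^ 2 := Finset.sum_nonneg fun i _ => sq_nonneg _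
  unfold potential; linarith

/-- The energy estimate for square integrable distributional solutions of
`-Δ ζ + potential ζ = 0`, obtained for mollifications of `ζ` and passed to the limit. -/
lemma energy_le (hd : 1 ≤ d) {ζ χ : E d → ℝ} (hζ : MemLp ζ 2 volume) (hχ : IsTest χ)
    (h : ∀ ψ : E d → ℝ, IsTest ψ → ∫ x, ζ x * (- lap ψ x + potential d x * ψ x) = 0) :
    1 / 4 * ∫ x, (χ x * ζ x) * (χ x * ζ x) ≤
      ∑ i, ∫ x, (pd i χ x * ζ x) * (pd i χ x * ζ x) := by
  have hl : LocallyIntegrable ζ volume := hζ.locallyIntegrable (by norm_num)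
  obtain ⟨R, hR⟩ := hχ.2.isCompact.isBounded.exists_norm_le
  have hχ0 : ∀ x, R < ‖x‖ → χ x = 0 := fun x hx => by
    by_contra h
    exact absurd (hR x (subset_tsupport χ h)) (not_le.2 hx)
  -- the potential is truncated outside the support of `χ` to stay in `L²`
  let B : Set (E d) := Metric.closedBall 0 (R + 1)
  let V : E d → ℝ := B.indicator (potential d)
  let F : E d → ℝ := fun x => V x * ζ x
  obtain ⟨C, hC⟩ := (isCompact_closedBall (0 : E d) (R + 1)).exists_bound_of_continuousOn
    (contDiff_potential (d := d)).continuous.continuousOn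
  have hVm : AEStronglyMeasurable V volume :=
    (contDiff_potential.continuous.aestronglyMeasurable).indicator
      Metric.isClosed_closedBall.measurableSet
  have hVb : ∀ x, |V x| ≤ |C| := by
    intro x
    by_cases hx : x ∈ B
    · simp only [V, Set.indicator_of_mem hx]
      exact (hC x hx).trans (le_abs_self C)
    · simp only [V, Set.indicator_of_notMem hx]
      simp
  have hF : MemLp F 2 volume := memLp_bdd_mul hζ hVm hVb
  obtain ⟨ρ, hρ, l1, l2⟩ := exists_mollifier_seq hζ hF
  obtain ⟨K, hK⟩ := hχ.exists_bound
  have hχm := hχ.1.continuous.aestronglyMeasurable (μ := (volume : Measure (E d)))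
  have lhs := (l1.bdd_mul hχm hK).tendsto_integral_mul (l2.bdd_mul hχm hK)
  have rhs : Tendsto (fun n => ∑ i, ∫ x, (pd i χ x * moll (ρ n) ζ x) *
      (pd i χ x * moll (ρ n) ζ x)) atTop
      (𝓝 (∑ i, ∫ x, (pd i χ x * ζ x) * (pd i χ x * ζ x))) := by
    refine tendsto_finsetSum _ fun i _ => ?_
    obtain ⟨K', hK'⟩ := (hχ.pd i).exists_bound
    have hm := (hχ.pd i).1.continuous.aestronglyMeasurable (μ := (volume : Measure (E d)))
    exact (l1.bdd_mul hm hK').tendsto_integral_mul (l1.bdd_mul hm hK')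
  have hle : ∀ n, ∫ x, χ x * moll (ρ n) ζ x * (χ x * moll (ρ n) F x) ≤
      ∑ i, ∫ x, (pd i χ x * moll (ρ n) ζ x) * (pd i χ x * moll (ρ n) ζ x) := by
    intro n
    have hρn := (hρ n).isTest
    refine le_trans (le_of_eq ?_)
      (integral_sq_mul_lap_le (contDiff_moll hρn hl) hχ)
    congr 1; funext x
    by_cases hx : R < ‖x‖
    · simp [hχ0 x hx]
    · congr 2
      have hψ := hρn.comp_sub_left x
      have h1 := h _ hψ
      have h2 : ∫ t, ζ t * (- lap (fun t => ρ n (x - t)) t + potential d t * ρ n (x - t)) =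
          - (∫ t, ζ t * lap (fun t => ρ n (x - t)) t) +
            ∫ t, ζ t * (potential d t * ρ n (x - t)) := by
        rw [← integral_neg]
        refine Eq.trans ?_ (integral_add (integrable_mul_test hl hψ.lap).neg
          (integrable_mul_test hl (hψ.smooth_mul contDiff_potential)))
        congr 1; funext t; ring
      rw [h2] at h1
      rw [lap_moll hρn hl, show moll (ρ n) F x = ∫ t, F t * ρ n (x - t) from rfl]
      have h3 : ∫ t, F t * ρ n (x - t) = ∫ t, ζ t * (potential d t * ρ n (x - t)) := by
        congr 1; funext t
        by_cases ht : t ∈ B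
        · simp only [F, V, Set.indicator_of_mem ht]; ring
        · have : 1 ≤ ‖x - t‖ := by
            have h4 : R + 1 < ‖t‖ := by simpa [B] using ht
            have h5 := norm_sub_norm_le t x
            rw [norm_sub_rev] at h5
            linarith
          simp [(hρ n).eq_zero _ this]
      linarith
  have hlim := le_of_tendsto_of_tendsto' lhs rhs hle
  refine le_trans ?_ hlim
  have m1 := memLp_bdd_mul hζ hχm hK
  have m2 := memLp_bdd_mul hF hχm hK
  rw [← integral_const_mul]
  refine integral_mono ((m1.integrable_mul m1).const_mul _) (m1.integrable_mul m2) fun x => ?_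
  by_cases hx : R < ‖x‖
  · simp [hχ0 x hx]
  · have hB : x ∈ B := by
      simp only [B, Metric.mem_closedBall, dist_zero_right]; linarith
    simp only [F, V, Set.indicator_of_mem hB]
    nlinarith [mul_le_mul_of_nonneg_right (one_quarter_le_potential hd x)
      (sq_nonneg (χ x * ζ x))]

/-- The Schrödinger operator `-Δ + potential` has no square integrable distributional kernel. -/
lemma ae_eq_zero_of_schroedinger (hd : 1 ≤ d) {ζ : E d → ℝ} (hζ : MemLp ζ 2 volume)
    (h : ∀ ψ : E d → ℝ, IsTest ψ → ∫ x, ζ x * (- lap ψ x + potential d x * ψ x) = 0) :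
    ζ =ᵐ[volume] 0 := by
  obtain ⟨χ, hχ, hχ0⟩ := exists_cutoff d
  have l1 := L2Lim.cutoff_mul hχ hζ
  have t1 := (l1.tendsto_integral_mul l1).const_mul (1 / 4)
  have t2 : Tendsto (fun n => ∑ i, ∫ x, (pd i (cutoff χ n) x * ζ x) * (pd i (cutoff χ n) x * ζ x))
      atTop (𝓝 (∑ _i : Fin d, ∫ _x : E d, (0 : ℝ) * 0)) :=
    tendsto_finsetSum _ fun i _ =>
      (L2Lim.pd_cutoff_mul hχ hζ i).tendsto_integral_mul (L2Lim.pd_cutoff_mul hχ hζ i)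
  have hle := le_of_tendsto_of_tendsto' t1 t2 fun n => energy_le hd hζ (hχ.cutoff n) h
  simp only [hχ0, one_mul, mul_zero, integral_zero, Finset.sum_const_zero] at hle
  have h1 := lpNorm_sq_eq_integral hζ
  simp only [sq (ζ _)] at h1
  have h2 : lpNorm ζ 2 volume ^ 2 ≤ 0 := by rw [h1]; linarith
  have h3 : lpNorm ζ 2 volume = 0 := by
    have := sq_nonneg (lpNorm ζ 2 (volume : Measure (E d)))
    exact pow_eq_zero_iff (two_ne_zero) |>.1 (le_antisymm h2 this)
  exact (lpNorm_eq_zero hζ (by norm_num)).1 h3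

lemma classicalL_add {u v : E d → ℝ} (hu : ContDiff ℝ ∞ u) (hv : ContDiff ℝ ∞ v) :
    classicalL (fun x => u x + v x) = fun x => classicalL u x + classicalL v x := by
  funext x
  simp only [classicalL, pd_add hu hv, pd_add (contDiff_pd hu _) (contDiff_pd hv _), mul_add,
    Finset.sum_add_distrib]
  ring

lemma classicalL_const_mul {u : E d → ℝ} (hu : ContDiff ℝ ∞ u) (c : ℝ) :
    classicalL (fun x => c * u x) = fun x => c * classicalL u x := by
  funext x
  simp only [classicalL, pd_const_mul hu, pd_const_mul (contDiff_pd hu _), Finset.mul_sum, mul_sub,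
    mul_neg]
  congr 2
  exact Finset.sum_congr rfl fun i _ => by ring

lemma classicalL_sub {u v : E d → ℝ} (hu : ContDiff ℝ ∞ u) (hv : ContDiff ℝ ∞ v) :
    classicalL (fun x => u x - v x) = fun x => classicalL u x - classicalL v x := by
  funext x
  simp only [classicalL, pd_sub hu hv, pd_sub (contDiff_pd hu _) (contDiff_pd hv _), mul_sub,
    Finset.sum_sub_distrib]
  ring

/-- The subspace of `L²(μ)` of the classes of `𝓛 η`, `η` a test function. -/
def rangeL (d : ℕ) : Submodule ℝ (Lp ℝ 2 (mu d)) where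
  carrier := {F | ∃ η : E d → ℝ, IsTest η ∧ F =ᵐ[mu d] classicalL η}
  zero_mem' := by
    refine ⟨fun _ => 0, IsTest.zero, ?_⟩
    have h := classicalL_const_mul (IsTest.zero (d := d)).1 0
    simp only [zero_mul] at h
    rw [h]
    exact Lp.coeFn_zero ℝ 2 (mu d)
  add_mem' := by
    rintro F G ⟨η, h, hF⟩ ⟨η', h', hG⟩
    refine ⟨_, h.add h', ?_⟩
    rw [classicalL_add h.1 h'.1]
    filter_upwards [Lp.coeFn_add F G, hF, hG] with x h1 h2 h3
    rw [h1, Pi.add_apply, h2, h3]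
  smul_mem' := by
    rintro c F ⟨η, h, hF⟩
    refine ⟨_, h.const_mul c, ?_⟩
    rw [classicalL_const_mul h.1 c]
    filter_upwards [Lp.coeFn_smul c F, hF] with x h1 h2
    rw [h1, Pi.smul_apply, h2, smul_eq_mul]

/-- `𝓛` maps the test functions onto a dense subspace of `L²(μ)`. -/
lemma rangeL_orthogonal (hd : 1 ≤ d) : (rangeL d)ᗮ = ⊥ := by
  rw [Submodule.eq_bot_iff]
  intro z hz
  rw [Submodule.mem_orthogonal'] at hz
  have hzm : MemLp z 2 (mu d) := Lp.memLp z
  have hz' : ∀ η : E d → ℝ, IsTest η → ∫ x, z x * classicalL η x ∂(mu d) = 0 := by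
    intro η hη
    have h1 := hz _ ⟨η, hη, (hη.classicalL.memLp_mu hd).coeFn_toLp⟩
    rw [← Lp.toLp_coeFn z hzm, inner_toLp_eq_integral] at h1
    exact h1
  have key : (fun x => gauss d (1 / 8) x * z x) =ᵐ[volume] 0 := by
    refine ae_eq_zero_of_schroedinger hd ((memLp_mu_iff hd).1 hzm) fun ψ hψ => ?_
    have hη : IsTest fun x => gauss d (-(1 / 8)) x * ψ x := hψ.smooth_mul (contDiff_gauss _)
    have h1 := hz' _ hη
    rw [integral_mu hd] at h1
    have h2 := (mul_eq_zero.1 h1).resolve_left (inv_ne_zero (Z_pos hd).ne')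
    rw [← h2]
    congr 1; funext x
    have e1 : (fun x => gauss d (1 / 8) x * (gauss d (-(1 / 8)) x * ψ x)) = ψ := by
      funext x
      rw [← mul_assoc, gauss_mul]; simp [gauss_zero]
    have e2 := gauss_mul_classicalL hη.1 x
    rw [e1, congrFun e1 x] at e2
    rw [← e2, show (1 / 4 : ℝ) = 1 / 8 + 1 / 8 by norm_num, ← gauss_mul]
    ring
  have hz0 : z =ᵐ[mu d] 0 := by
    rw [Filter.EventuallyEq, ae_mu hd]
    filter_upwards [key] with x hx
    exact (mul_eq_zero.1 hx).resolve_left (gauss_pos _ _).ne'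
  exact (Lp.eq_zero_iff_ae_eq_zero).2 hz0

lemma exists_classicalL_approx (hd : 1 ≤ d) {f : E d → ℝ} (hf : MemLp f 2 (mu d)) :
    ∃ η : ℕ → E d → ℝ, (∀ n, IsTest (η n)) ∧ L2Lim (mu d) (fun n => classicalL (η n)) f := by
  have h1 : (rangeL d).topologicalClosure = ⊤ :=
    Submodule.topologicalClosure_eq_top_iff.2 (rangeL_orthogonal hd)
  have h2 : hf.toLp f ∈ closure (rangeL d : Set (Lp ℝ 2 (mu d))) := by
    rw [← Submodule.topologicalClosure_coe, h1]; trivial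
  obtain ⟨F, hF, hlim⟩ := mem_closure_iff_seq_limit.1 h2
  choose η hη hFη using hF
  refine ⟨η, hη, fun n => (hη n).classicalL.memLp_mu hd, hf, ?_⟩
  refine hlim.congr fun n => Lp.ext ?_
  exact (hFη n).trans ((hη n).classicalL.memLp_mu hd).coeFn_toLp.symm

/-! ### Passage from test functions to `H²(μ)` -/

section IsH2
variable {ν : Measure (E d)} {u : E d → ℝ} {g : Fin d → E d → ℝ} {h : Fin d → Fin d → E d → ℝ}

lemma IsH2.hasWeakDeriv_one (hu : IsH2 ν u g h) (α : Fin 1 → Fin d) :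
    HasWeakDeriv α u (g (α 0)) := WeightedSobolev.hasWeakDeriv_one.2 (hu.grad _)

lemma IsH2.hasWeakDeriv_two (hu : IsH2 ν u g h) (α : Fin 2 → Fin d) :
    HasWeakDeriv α u (h (α 0) (α 1)) :=
  (WeightedSobolev.hasWeakDeriv_two (hu.grad _)).2 (hu.hess _ _)

lemma IsH2.hasWeakDeriv_zero (hd : 1 ≤ d) (hu : IsH2 ν u g h) (α : Fin 0 → Fin d) :
    HasWeakDeriv α u u := WeightedSobolev.hasWeakDeriv_zero (hu.grad ⟨0, hd⟩).1

lemma IsH2.memH (hd : 1 ≤ d) (hu : IsH2 ν u g h) : MemH 2 ν u := by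
  refine ⟨hu.memLp, fun k hk => ?_⟩
  interval_cases k
  · exact fun α => ⟨u, hu.hasWeakDeriv_zero hd α, hu.memLp⟩
  · exact fun α => ⟨_, hu.hasWeakDeriv_one α, hu.memLp_grad _⟩
  · exact fun α => ⟨_, hu.hasWeakDeriv_two α, hu.memLp_hess _ _⟩

lemma exists_isH2 (hu : MemH 2 ν u) : ∃ g h, IsH2 ν u g h := by
  have h1 : ∀ i : Fin d, ∃ g, HasWeakDeriv ![i] u g ∧ MemLp g 2 ν := fun i =>
    hu.2 1 (by norm_num) _
  have h2 : ∀ i j : Fin d, ∃ g, HasWeakDeriv ![i, j] u g ∧ MemLp g 2 ν := fun i j =>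
    hu.2 2 le_rfl _
  choose g hg hg' using h1
  choose h hh hh' using h2
  have hW : ∀ i, WD i u (g i) := fun i => WeightedSobolev.hasWeakDeriv_one.1 (hg i)
  exact ⟨g, h, hu.1, hg', hh', hW, fun i j =>
    (WeightedSobolev.hasWeakDeriv_two (α := ![i, j]) (hW j)).1 (hh i j)⟩

lemma IsH2.laplacian_ae_eq (hu : IsH2 ν u g h) :
    laplacian u =ᵐ[volume] fun x => ∑ i, h i i x := by
  have h2 : ∀ᵐ x, ∀ i, weakDeriv ![i, i] u x = h i i x :=
    ae_all_iff.2 fun i => weakDeriv_ae_eq (hu.hasWeakDeriv_two ![i, i])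
  filter_upwards [h2] with x hx2
  simp only [laplacian, hx2]

lemma IsH2.opL_ae_eq (hu : IsH2 ν u g h) :
    opL u =ᵐ[volume] fun x => -(∑ i, x i / 2 * g i x) - ∑ i, h i i x := by
  have h1 : ∀ᵐ x, ∀ i, weakDeriv ![i] u x = g i x :=
    ae_all_iff.2 fun i => weakDeriv_ae_eq (hu.hasWeakDeriv_one ![i])
  filter_upwards [h1, hu.laplacian_ae_eq] with x hx1 hx2
  simp only [opL, hx1, hx2]

end IsH2

lemma ae_eq_mu (hd : 1 ≤ d) {f g : E d → ℝ} : f =ᵐ[mu d] g ↔ f =ᵐ[volume] g := by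
  rw [Filter.EventuallyEq, ae_mu hd]; rfl

/-- Multiplication by a smooth function is a closed operator in `L²(μ)`. -/
lemma L2Lim.ae_eq_smooth_mul (hd : 1 ≤ d) {F : ℕ → E d → ℝ} {f k a : E d → ℝ}
    (hF : L2Lim (mu d) F f) (ha : ContDiff ℝ ∞ a)
    (hk : L2Lim (mu d) (fun n x => a x * F n x) k) : k =ᵐ[mu d] fun x => a x * f x := by
  rw [ae_eq_mu hd]
  refine ae_eq_of_forall_test (locallyIntegrable_of_memLp_mu hd hk.memLp_lim)
    (LocallyIntegrable.smooth_mul (locallyIntegrable_of_memLp_mu hd hF.memLp_lim) ha)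
    fun ψ hψ => ?_
  have h1 := hk.tendsto_integral_test hd hψ
  have h2 := hF.tendsto_integral_test hd (hψ.smooth_mul ha)
  have e : ∀ (b : E d → ℝ), ∫ x, b x * (a x * ψ x) = ∫ x, a x * b x * ψ x := fun b => by
    congr 1; funext x; ring
  simp only [e] at h2
  exact tendsto_nhds_unique h1 h2

/-- The sequence `η` of test functions converges in `H²(μ)` to `u`. -/
structure H2Approx (η : ℕ → E d → ℝ) (u : E d → ℝ) (g : Fin d → E d → ℝ)
    (h : Fin d → Fin d → E d → ℝ) : Prop where
  isTest : ∀ n, IsTest (η n)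
  lim : L2Lim (mu d) η u
  lim_grad : ∀ i, L2Lim (mu d) (fun n => pd i (η n)) (g i)
  lim_hess : ∀ i j, L2Lim (mu d) (fun n => pd i (pd j (η n))) (h i j)

namespace H2Approx
variable {η : ℕ → E d → ℝ} {u : E d → ℝ} {g : Fin d → E d → ℝ} {h : Fin d → Fin d → E d → ℝ}

lemma isH2 (hd : 1 ≤ d) (H : H2Approx η u g h) : IsH2 (mu d) u g h where
  memLp := H.lim.memLp_lim
  memLp_grad i := (H.lim_grad i).memLp_lim
  memLp_hess i j := (H.lim_hess i j).memLp_lim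
  grad i := WD.of_L2Lim_mu hd H.lim (H.lim_grad i) fun n => WD.of_smooth (H.isTest n).1 i
  hess i j := WD.of_L2Lim_mu hd (H.lim_grad j) (H.lim_hess i j) fun n =>
    WD.of_smooth ((H.isTest n).pd j).1 i

/-- Multiplication by a coordinate costs one derivative. -/
lemma coord_mul_lim (hd : 1 ≤ d) {F : ℕ → E d → ℝ} {f k : E d → ℝ} (i : Fin d)
    (hF : ∀ n, IsTest (F n)) (hf : L2Lim (mu d) F f)
    (hk : L2Lim (mu d) (fun n => pd i (F n)) k) :
    L2Lim (mu d) (fun n x => x i * F n x) (fun x => x i * f x) := by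
  obtain ⟨l, hl⟩ := hk.exists_of_le (ν := mu d) (F := fun n x => x i * F n x)
    (fun n => ((hF n).smooth_mul (contDiff_coord i)).memLp) 4 fun n m => by
      have := lpNorm_coord_mul_le_pd hd ((hF n).sub (hF m)) i
      rw [pd_sub (hF n).1 (hF m).1] at this
      simpa only [mul_sub] using this
  exact hl.congr_lim (hf.ae_eq_smooth_mul hd (contDiff_coord i) hl)

lemma lim_coord_mul (hd : 1 ≤ d) (H : H2Approx η u g h) (i : Fin d) :
    L2Lim (mu d) (fun n x => x i * η n x) (fun x => x i * u x) :=
  coord_mul_lim hd i H.isTest H.lim (H.lim_grad i)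

lemma lim_coord_mul_grad (hd : 1 ≤ d) (H : H2Approx η u g h) (i : Fin d) :
    L2Lim (mu d) (fun n x => x i * pd i (η n) x) (fun x => x i * g i x) :=
  coord_mul_lim hd i (fun n => (H.isTest n).pd i) (H.lim_grad i) (H.lim_hess i i)

lemma lim_opL (hd : 1 ≤ d) (H : H2Approx η u g h) :
    L2Lim (mu d) (fun n => classicalL (η n)) (opL u) := by
  have h1 : L2Lim (mu d) (fun n x => -(∑ i, 1 / 2 * (x i * pd i (η n) x)) -
      ∑ i, pd i (pd i (η n)) x) (fun x => -(∑ i, 1 / 2 * (x i * g i x)) - ∑ i, h i i x) :=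
    (L2Lim.sum _ fun i _ => (H.lim_coord_mul_grad hd i).const_mul _).neg.sub
      (L2Lim.sum _ fun i _ => H.lim_hess i i)
  have e : ∀ a b : ℝ, 1 / 2 * (a * b) = a / 2 * b := fun a b => by ring
  simp only [e] at h1
  exact h1.congr_lim ((ae_eq_mu hd).2 (H.isH2 hd).opL_ae_eq.symm)

end H2Approx

lemma exists_h2Approx (hd : 1 ≤ d) {u : E d → ℝ} (hu : MemH 2 (mu d) u) :
    ∃ η g h, H2Approx η u g h := by
  obtain ⟨g, h, hu⟩ := exists_isH2 hu
  obtain ⟨η, h1, h2, h3, h4⟩ := hu.exists_test_approx hd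
  exact ⟨η, g, h, h1, h2, h3, h4⟩

/-- The operator `𝓛` maps `H²(μ)` to `L²(μ)`. -/
lemma memLp_opL (hd : 1 ≤ d) {u : E d → ℝ} (hu : MemH 2 (mu d) u) : MemLp (opL u) 2 (mu d) := by
  obtain ⟨η, g, h, H⟩ := exists_h2Approx hd hu
  exact (H.lim_opL hd).memLp_lim

lemma memH_and_opL_linear (hd : 1 ≤ d) (a b : ℝ) {u v w : E d → ℝ} (hu : MemH 2 (mu d) u)
    (hv : MemH 2 (mu d) v) (hw : w =ᵐ[mu d] fun x => a * u x + b * v x) :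
    MemH 2 (mu d) w ∧ opL w =ᵐ[mu d] fun x => a * opL u x + b * opL v x := by
  obtain ⟨g, h, hu⟩ := exists_isH2 hu
  obtain ⟨g', h', hv⟩ := exists_isH2 hv
  have H : IsH2 (mu d) w (fun i x => a * g i x + b * g' i x)
      (fun i j x => a * h i j x + b * h' i j x) :=
    { memLp := ((hu.memLp.const_mul a).add (hv.memLp.const_mul b)).ae_eq hw.symm
      memLp_grad := fun i => ((hu.memLp_grad i).const_mul a).add ((hv.memLp_grad i).const_mul b)
      memLp_hess := fun i j =>
        ((hu.memLp_hess i j).const_mul a).add ((hv.memLp_hess i j).const_mul b)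
      grad := fun i => (((hu.grad i).const_mul a).add ((hv.grad i).const_mul b)).congr
        ((ae_eq_mu hd).1 hw).symm (ae_eq_refl _)
      hess := fun i j => ((hu.hess i j).const_mul a).add ((hv.hess i j).const_mul b) }
  refine ⟨H.memH hd, (ae_eq_mu hd).2 ?_⟩
  filter_upwards [H.opL_ae_eq, hu.opL_ae_eq, hv.opL_ae_eq] with x h1 h2 h3
  rw [h1, h2, h3]
  have e : ∀ i, x i / 2 * (a * g i x + b * g' i x) =
      a * (x i / 2 * g i x) + b * (x i / 2 * g' i x) := fun i => by ring
  simp only [e, Finset.sum_add_distrib, ← Finset.mul_sum]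
  ring

lemma lpNorm_le_normH2 (hd : 1 ≤ d) {u : E d → ℝ} (hu : MemH 2 (mu d) u) :
    lpNorm u 2 (mu d) ≤ 4 * normH2 u := by
  obtain ⟨η, g, h, H⟩ := exists_h2Approx hd hu
  exact le_of_tendsto_of_tendsto' H.lim.tendsto_lpNorm
    ((H.lim_opL hd).tendsto_lpNorm.const_mul 4) fun n => lpNorm_le_classicalL hd (H.isTest n)

lemma lpNorm_weakDeriv_le_normH2 (hd : 1 ≤ d) {u : E d → ℝ} (hu : MemH 2 (mu d) u) {k : ℕ}
    (hk : k ≤ 2) (α : Fin k → Fin d) :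
    lpNorm (weakDeriv α u) 2 (mu d) ≤ (6 + 2 * d) * normH2 u := by
  obtain ⟨η, g, h, H⟩ := exists_h2Approx hd hu
  have hH := H.isH2 hd
  have h0 : 0 ≤ normH2 u := lpNorm_nonneg
  have hN := (H.lim_opL hd).tendsto_lpNorm
  have hdn : 0 ≤ d * normH2 u := by positivity
  interval_cases k
  · rw [lpNorm_congr_ae ((ae_eq_mu hd).2 (weakDeriv_ae_eq (hH.hasWeakDeriv_zero hd α)))]
    linarith [lpNorm_le_normH2 hd hu]
  · rw [lpNorm_congr_ae ((ae_eq_mu hd).2 (weakDeriv_ae_eq (hH.hasWeakDeriv_one α)))]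
    have := le_of_tendsto_of_tendsto' (H.lim_grad (α 0)).tendsto_lpNorm (hN.const_mul 2)
      fun n => lpNorm_pd_le_classicalL hd (H.isTest n) _
    unfold normH2 at *
    linarith
  · rw [lpNorm_congr_ae ((ae_eq_mu hd).2 (weakDeriv_ae_eq (hH.hasWeakDeriv_two α)))]
    have := le_of_tendsto_of_tendsto' (H.lim_hess (α 0) (α 1)).tendsto_lpNorm
      (hN.const_mul ((1 + (d : ℝ)) * 2)) fun n => lpNorm_pd_pd_le_classicalL hd (H.isTest n) _ _
    unfold normH2 at *
    linarith

lemma exists_sobolevNorm_le (hd : 1 ≤ d) :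
    ∃ C > 0, ∀ u : E d → ℝ, MemH 2 (mu d) u → sobolevNorm 2 (mu d) u ≤ C * normH2 u := by
  have : Nonempty (Fin d) := ⟨⟨0, hd⟩⟩
  refine ⟨√(∑ k ∈ Finset.range (2 + 1), ∑ _α : Fin k → Fin d, (6 + 2 * d : ℝ) ^ 2),
    Real.sqrt_pos.2 ?_, fun u hu => ?_⟩
  · exact Finset.sum_pos (fun k _ => Finset.sum_pos (fun _ _ => by positivity)
      Finset.univ_nonempty) (by simp)
  · have h0 : 0 ≤ normH2 u := lpNorm_nonneg
    rw [sobolevNorm]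
    rw [← Real.sqrt_sq h0, ← Real.sqrt_mul' _ (sq_nonneg _)]
    refine Real.sqrt_le_sqrt ?_
    simp only [Finset.sum_mul, ← mul_pow]
    refine Finset.sum_le_sum fun k hk => Finset.sum_le_sum fun α _ => ?_
    have h1 : 0 ≤ lpNorm (weakDeriv α u) 2 (mu d) := lpNorm_nonneg
    have h2 := lpNorm_weakDeriv_le_normH2 hd hu (Nat.lt_succ_iff.1 (Finset.mem_range.1 hk)) α
    gcongr

lemma lpNorm_weakDeriv_le_sobolevNorm {ν : Measure (E d)} {u : E d → ℝ} {n k : ℕ} (hk : k ≤ n)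
    (α : Fin k → Fin d) : lpNorm (weakDeriv α u) 2 ν ≤ sobolevNorm n ν u := by
  rw [sobolevNorm]
  refine Real.le_sqrt_of_sq_le ?_
  refine (Finset.single_le_sum (f := fun α : Fin k → Fin d => lpNorm (weakDeriv α u) 2 ν ^ 2)
    (fun _ _ => sq_nonneg _) (Finset.mem_univ α)).trans ?_
  exact Finset.single_le_sum
    (f := fun k => ∑ α : Fin k → Fin d, lpNorm (weakDeriv α u) 2 ν ^ 2)
    (fun _ _ => Finset.sum_nonneg fun _ _ => sq_nonneg _)
    (Finset.mem_range.2 (Nat.lt_succ_of_le hk))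

lemma lpNorm_classicalL_le (hd : 1 ≤ d) {u : E d → ℝ} (hu : IsTest u) :
    lpNorm (classicalL u) 2 (mu d) ≤ ∑ i, 3 * lpNorm (pd i (pd i u)) 2 (mu d) := by
  let A : Fin d → E d → ℝ := fun i x => x i * pd i u x
  have m1 : ∀ i, MemLp (A i) 2 (mu d) := fun i =>
    ((hu.pd i).smooth_mul (contDiff_coord i)).memLp
  have m2 : ∀ i, MemLp (pd i (pd i u)) 2 (mu d) := fun i => ((hu.pd i).pd i).memLp
  have e : classicalL u = ∑ i, ((-(1 / 2) : ℝ) • A i - pd i (pd i u)) := by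
    funext x
    simp only [classicalL, Finset.sum_apply, Finset.sum_sub_distrib, Pi.sub_apply, Pi.smul_apply,
      smul_eq_mul, A]
    rw [← Finset.sum_neg_distrib]
    congr 1
    exact Finset.sum_congr rfl fun i _ => by ring
  rw [e]
  refine (lpNorm_sum_le (fun i _ => ((m1 i).const_smul _).sub (m2 i)) (by norm_num)).trans ?_
  refine Finset.sum_le_sum fun i _ => ?_
  refine (lpNorm_sub_le ((m1 i).const_smul _) (by norm_num)).trans ?_
  rw [lpNorm_const_smul]
  have h1 : lpNorm (A i) 2 (mu d) ≤ 4 * lpNorm (pd i (pd i u)) 2 (mu d) :=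
    lpNorm_coord_mul_le_pd hd (hu.pd i) i
  have h2 : ((‖(-(1 / 2) : ℝ)‖₊ : NNReal) : ℝ) = 1 / 2 := by norm_num
  rw [h2]
  linarith

lemma normH2_le (hd : 1 ≤ d) {u : E d → ℝ} (hu : MemH 2 (mu d) u) :
    normH2 u ≤ 3 * d * sobolevNorm 2 (mu d) u := by
  obtain ⟨η, g, h, H⟩ := exists_h2Approx hd hu
  have hH := H.isH2 hd
  have hb : ∀ n, lpNorm (classicalL (η n)) 2 (mu d) ≤
      ∑ i, 3 * lpNorm (pd i (pd i (η n))) 2 (mu d) := fun n =>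
    lpNorm_classicalL_le hd (H.isTest n)
  have hlim := le_of_tendsto_of_tendsto' (H.lim_opL hd).tendsto_lpNorm
    (tendsto_finsetSum _ fun i _ => (H.lim_hess i i).tendsto_lpNorm.const_mul 3) hb
  refine hlim.trans ?_
  have h2 : ∀ i, lpNorm (h i i) 2 (mu d) ≤ sobolevNorm 2 (mu d) u := fun i => by
    refine le_of_eq_of_le (lpNorm_congr_ae
      ((ae_eq_mu hd).2 (weakDeriv_ae_eq (hH.hasWeakDeriv_two ![i, i])))).symm ?_
    exact lpNorm_weakDeriv_le_sobolevNorm le_rfl _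
  calc _ ≤ ∑ _i : Fin d, 3 * sobolevNorm 2 (mu d) u :=
        Finset.sum_le_sum fun i _ => by linarith [h2 i]
    _ = _ := by simp; ring

lemma ae_eq_of_opL_ae_eq (hd : 1 ≤ d) {u v : E d → ℝ} (hu : MemH 2 (mu d) u)
    (hv : MemH 2 (mu d) v) (h : opL v =ᵐ[mu d] opL u) : v =ᵐ[mu d] u := by
  obtain ⟨h1, h2⟩ := memH_and_opL_linear hd 1 (-1) hv hu (ae_eq_refl _)
  have h3 := lpNorm_le_normH2 hd h1
  have h4 : opL (fun x => 1 * v x + -1 * u x) =ᵐ[mu d] fun _ => 0 := by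
    filter_upwards [h, h2] with x e1 e2
    rw [e2, e1]; ring
  rw [normH2, lpNorm_congr_ae h4, lpNorm_fun_zero, mul_zero] at h3
  have h5 := (lpNorm_eq_zero h1.1 (by norm_num)).1 (le_antisymm h3 lpNorm_nonneg)
  filter_upwards [h5] with x hx
  simp only [Pi.zero_apply] at hx
  linarith

/-- Surjectivity of `𝓛`: a sequence of test functions whose images approximate `f` converges in
`H²(μ)` by the a priori estimates. -/
lemma exists_opL_ae_eq (hd : 1 ≤ d) {f : E d → ℝ} (hf : MemLp f 2 (mu d)) :
    ∃ u : E d → ℝ, MemH 2 (mu d) u ∧ opL u =ᵐ[mu d] f := by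
  obtain ⟨η, hη, hlim⟩ := exists_classicalL_approx hd hf
  obtain ⟨u, hu⟩ := hlim.exists_of_le (ν := mu d) (F := η) (fun n => (hη n).memLp) 4
    fun n m => by
      have := lpNorm_le_classicalL hd ((hη n).sub (hη m))
      rwa [classicalL_sub (hη n).1 (hη m).1] at this
  have h1 : ∀ i, ∃ g, L2Lim (mu d) (fun n => pd i (η n)) g := fun i =>
    hlim.exists_of_le (fun n => ((hη n).pd i).memLp) 2 fun n m => by
      have := lpNorm_pd_le_classicalL hd ((hη n).sub (hη m)) i
      rwa [classicalL_sub (hη n).1 (hη m).1, pd_sub (hη n).1 (hη m).1] at this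
  have h2 : ∀ i j, ∃ h, L2Lim (mu d) (fun n => pd i (pd j (η n))) h := fun i j =>
    hlim.exists_of_le (fun n => (((hη n).pd j).pd i).memLp) ((1 + d) * 2) fun n m => by
      have := lpNorm_pd_pd_le_classicalL hd ((hη n).sub (hη m)) i j
      rwa [classicalL_sub (hη n).1 (hη m).1, pd_sub (hη n).1 (hη m).1,
        pd_sub ((hη n).pd j).1 ((hη m).pd j).1] at this
  choose g hg using h1
  choose h hh using h2
  have H : H2Approx η u g h := ⟨hη, hu, hg, hh⟩
  exact ⟨u, (H.isH2 hd).memH hd, (H.lim_opL hd).unique hlim⟩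

/-! ### The transformed function -/

lemma lpNorm_lap_gauss_mul_le (hd : 1 ≤ d) {u : E d → ℝ} (hu : IsTest u) :
    lpNorm (lap fun x => gauss d (1 / 8) x * u x) 2 volume ≤
      √(Z d) * lpNorm (classicalL u) 2 (mu d) := by
  have hφ := hu.smooth_mul (contDiff_gauss (d := d) (1 / 8))
  have hm := hu.classicalL.memLp_mu hd
  rw [← lpNorm_gauss_mul hd hm, ← one_mul (lpNorm (fun x => gauss d (1 / 8) x * _) 2 volume)]
  refine lpNorm_le_of_integral_sq_le hφ.lap.memLp ((memLp_mu_iff hd).1 hm) zero_le_one ?_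
  simp only [gauss_mul_classicalL hu.1]
  rw [one_pow, one_mul]
  exact integral_lap_sq_le hd hφ

lemma lpNorm_lap_sq {f : E d → ℝ} (hf : IsTest f) :
    lpNorm (lap f) 2 volume ^ 2 = ∑ i, ∑ j, lpNorm (pd i (pd j f)) 2 volume ^ 2 := by
  rw [lpNorm_sq_eq_integral hf.lap.memLp, integral_lap_sq hf]
  simp only [fun i j => lpNorm_sq_eq_integral (ν := volume) ((hf.pd j).pd i).memLp]

lemma lpNorm_pd_pd_le_lap {f : E d → ℝ} (hf : IsTest f) (i j : Fin d) :
    lpNorm (pd i (pd j f)) 2 volume ≤ lpNorm (lap f) 2 volume := by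
  refine le_of_sq_le_sq ?_ lpNorm_nonneg
  rw [lpNorm_lap_sq hf]
  refine (Finset.single_le_sum (f := fun j => lpNorm (pd i (pd j f)) 2 volume ^ 2)
    (fun _ _ => sq_nonneg _) (Finset.mem_univ j)).trans ?_
  exact Finset.single_le_sum (f := fun i => ∑ j, lpNorm (pd i (pd j f)) 2 volume ^ 2)
    (fun _ _ => Finset.sum_nonneg fun _ _ => sq_nonneg _) (Finset.mem_univ i)

/-- The Hessian of `φ` in `L²` is obtained as a limit, since `‖D²φ‖ = ‖Δφ‖ ≤ √Z ‖𝓛u‖` for test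
functions makes the Hessians of the approximations a Cauchy sequence. -/
lemma gauss_mul_memH (hd : 1 ≤ d) {u φ : E d → ℝ} (hu : MemH 2 (mu d) u)
    (hφ : φ = fun x => Real.exp (‖x‖ ^ 2 / 8) * u x) :
    MemH 2 volume φ ∧ hessianNorm φ = lpNorm (laplacian φ) 2 volume ∧
      lpNorm (laplacian φ) 2 volume ≤ √(Z d) * normH2 u := by
  obtain ⟨η, g, h, H⟩ := exists_h2Approx hd hu
  have hφ' : φ = fun x => gauss d (1 / 8) x * u x := by
    rw [hφ]; funext x; rw [gauss]; congr 2; ring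
  let ψ : ℕ → E d → ℝ := fun n x => gauss d (1 / 8) x * η n x
  have hψ : ∀ n, IsTest (ψ n) := fun n => (H.isTest n).smooth_mul (contDiff_gauss _)
  have l0 : L2Lim volume ψ φ := by
    rw [hφ']; exact H.lim.gauss_mul hd
  have l1 : ∀ i, ∃ G, L2Lim volume (fun n => pd i (ψ n)) G := fun i => by
    have := ((H.lim_grad i).add ((H.lim_coord_mul hd i).const_mul (2 * (1 / 8)))).gauss_mul hd
    refine ⟨_, this.congr fun n => ?_⟩
    rw [pd_gauss_mul (H.isTest n).1]
  have l2 : ∀ i j, ∃ G, L2Lim volume (fun n => pd i (pd j (ψ n))) G := fun i j =>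
    (H.lim_opL hd).exists_of_le (fun n => (((hψ n).pd j).pd i).memLp) (√(Z d)) fun n m => by
      have h1 := (lpNorm_pd_pd_le_lap ((hψ n).sub (hψ m)) i j)
      have e : (fun x => ψ n x - ψ m x) = fun x => gauss d (1 / 8) x * (η n x - η m x) := by
        funext x; simp only [ψ]; ring
      have h2 := lpNorm_lap_gauss_mul_le hd ((H.isTest n).sub (H.isTest m))
      rw [classicalL_sub (H.isTest n).1 (H.isTest m).1, ← e] at h2
      rw [pd_sub (hψ n).1 (hψ m).1, pd_sub ((hψ n).pd j).1 ((hψ m).pd j).1] at h1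
      exact h1.trans h2
  choose G hG using l1
  choose K hK using l2
  have hφH : IsH2 volume φ G K :=
    { memLp := l0.memLp_lim
      memLp_grad := fun i => (hG i).memLp_lim
      memLp_hess := fun i j => (hK i j).memLp_lim
      grad := fun i => WD.of_L2Lim l0 (hG i) fun n => WD.of_smooth (hψ n).1 i
      hess := fun i j => WD.of_L2Lim (hG j) (hK i j) fun n => WD.of_smooth ((hψ n).pd j).1 i }
  have llap : L2Lim volume (fun n => lap (ψ n)) (laplacian φ) :=
    (L2Lim.sum Finset.univ fun i _ => hK i i).congr_lim hφH.laplacian_ae_eq.symm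
  refine ⟨hφH.memH hd, ?_, ?_⟩
  · have t1 := llap.tendsto_lpNorm.pow 2
    have t2 : Tendsto (fun n => ∑ i, ∑ j, lpNorm (pd i (pd j (ψ n))) 2 volume ^ 2) atTop
        (𝓝 (∑ i, ∑ j, lpNorm (weakDeriv ![i, j] φ) 2 volume ^ 2)) := by
      refine tendsto_finsetSum _ fun i _ => tendsto_finsetSum _ fun j _ => ?_
      rw [lpNorm_congr_ae (weakDeriv_ae_eq (hφH.hasWeakDeriv_two ![i, j]))]
      exact (hK i j).tendsto_lpNorm.pow 2
    have := tendsto_nhds_unique t2 (t1.congr fun n => lpNorm_lap_sq (hψ n))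
    rw [hessianNorm, this, Real.sqrt_sq lpNorm_nonneg]
  · exact le_of_tendsto_of_tendsto' llap.tendsto_lpNorm
      ((H.lim_opL hd).tendsto_lpNorm.const_mul _)
      fun n => lpNorm_lap_gauss_mul_le hd (H.isTest n)

end WeightedSobolev

open WeightedSobolev in
theorem lemma2p7 (d : ℕ) (hd : 1 ≤ d) :
    -- `𝓛` maps `H²(μ)` to `L²(μ)`
    (∀ u : E d → ℝ, MemH 2 (mu d) u → MemLp (opL u) 2 (mu d)) ∧
    -- `H²(μ)` is a vector space and `𝓛` is linear, modulo almost everywhere equality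
    (∀ (a b : ℝ) (u v w : E d → ℝ), MemH 2 (mu d) u → MemH 2 (mu d) v →
      (w =ᵐ[mu d] fun x => a * u x + b * v x) →
        MemH 2 (mu d) w ∧ opL w =ᵐ[mu d] fun x => a * opL u x + b * opL v x) ∧
    -- `𝓛 u = f` has a unique solution `u ∈ H²(μ)` for every `f ∈ L²(μ)`
    (∀ f : E d → ℝ, MemLp f 2 (mu d) →
      ∃ u : E d → ℝ, MemH 2 (mu d) u ∧ opL u =ᵐ[mu d] f ∧
        ∀ v : E d → ℝ, MemH 2 (mu d) v → opL v =ᵐ[mu d] f → v =ᵐ[mu d] u) ∧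
    -- `𝓛⁻¹` is bounded, and so is `𝓛`: `‖𝓛 ·‖_{L²(μ)}` is equivalent to the usual norm of `H²(μ)`
    (∃ C > 0, ∀ u : E d → ℝ, MemH 2 (mu d) u → sobolevNorm 2 (mu d) u ≤ C * normH2 u) ∧
    (∃ C > 0, ∀ u : E d → ℝ, MemH 2 (mu d) u → normH2 u ≤ C * sobolevNorm 2 (mu d) u) ∧
    -- the function `φ = e^{|x|²/8} u`
    (∀ u φ : E d → ℝ, MemH 2 (mu d) u → (φ = fun x => Real.exp (‖x‖ ^ 2 / 8) * u x) →
      MemH 2 volume φ ∧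
      hessianNorm φ = lpNorm (laplacian φ) 2 volume ∧
      lpNorm (laplacian φ) 2 volume ≤ √(Z d) * normH2 u) := by
  refine ⟨fun u hu => memLp_opL hd hu,
    fun a b u v w hu hv hw => memH_and_opL_linear hd a b hu hv hw, fun f hf => ?_,
    exists_sobolevNorm_le hd, ⟨3 * d, ?_, fun u hu => normH2_le hd hu⟩,
    fun u φ hu hφ => gauss_mul_memH hd hu hφ⟩
  · obtain ⟨u, hu, hLu⟩ := exists_opL_ae_eq hd hf
    exact ⟨u, hu, hLu, fun v hv hLv => ae_eq_of_opL_ae_eq hd hu hv (hLv.trans hLu.symm)⟩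
  · have : (0 : ℝ) < d := by exact_mod_cast hd
    positivity
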